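/- **Conventions.** Let $k$ be a field. A *quasi-Hopf algebra* over $k$ is a $k$-algebra $A$ with algebra maps $\Delta:A\to A\otimes A$ and $\varepsilon:A\to k$, an invertible $\Phi\in A^{\otimes 3}$, a linear map $S:A\to A$ with $S(1)=1$, $S(ab)=S(b)S(a)$, and elements $\alpha,\beta\in A$, such that, for $a\in A$ and with $\Psi=\Phi^{-1}$, $$(\varepsilon\otimes\mathrm{id})\Delta(a)=a=(\mathrm{id}\otimes\varepsilon)\Delta(a),\qquad (\Delta\otimes\mathrm{id})(\Delta(a))\,\Phi=\Phi\,(\mathrm{id}\otimes\Delta)(\Delta(a)),\qquad (\mathrm{id}\otimes\varepsilon\otimes\mathrm{id})(\Phi)=1\otimes 1,$$ $$(\Delta\otimes\mathrm{id}\otimes\mathrm{id})(\Phi)\,(\mathrm{id}\otimes\mathrm{id}\otimes\Delta)(\Phi)=(\Phi\otimes 1)\,(\mathrm{id}\otimes\Delta\otimes\mathrm{id})(\Phi)\,(1\otimes\Phi),$$ $$\sum S(a')\,\alpha\, a''=\varepsilon(a)\alpha,\quad \sum a'\beta S(a'')=\varepsilon(a)\beta,\quad \sum S(\Phi_1)\alpha\Phi_2\beta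 S(\Phi_3)=1,\quad \sum\Psi_1\beta S(\Psi_2)\alpha\Psi_3=1 .$$ It is *quasi-triangular* if it carries an invertible $R\in A\otimes A$ with $R\,\Delta(a)=\Delta^{\mathrm{op}}(a)\,R$ and $$(\Delta\otimes\mathrm{id})(R)=(\Phi^{-1})_{231}\,R_{13}\,\Phi_{132}\,R_{23}\,\Phi^{-1},\qquad (\mathrm{id}\otimes\Delta)(R)=\Phi_{312}\,R_{13}\,(\Phi^{-1})_{213}\,R_{12}\,\Phi ,$$ where, for $X=\sum X_1\otimes X_2\otimes X_3$, $X_{ijl}=\sum X_i\otimes X_j\otimes X_l$. Put $M=R_{21}R$. It is *ribbon* if it carries a non-zero central element $v$ with $M\,\Delta(v)=v\otimes v$ and $S(v)=v$. Let $A$ be a finite-dimensional ribbon quasi-Hopf algebra over $k$. (Then $v$ is automatically invertible.) $\mathrm{Rep}\,A$ is the category of finite-dimensional $A$-modules with tensor product $\otimes_k$ ($A$ acting via $\Delta$), unit object $\mathbf 1=k$ ($A$ acting via $\varepsilon$), associator $U\otimes(V\otimes W)\to(U\otimes V)\otimes W$ given by the action of $\Phi$, the unit isomorphisms of vector spaces,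 braiding $u\otimes w\mapsto\tau(R.(u\otimes w))$ with $\tau$ the flip, duals $U^*=\mathrm{Hom}_k(U,k)$ with $(a.f)(u)=f(S(a).u)$, $\mathrm{ev}_U(f\otimes u)=f(\alpha.u)$ and $\mathrm{coev}_U(1)=\sum_i\beta.u_i\otimes u_i^*$, and ribbon twist $\theta$ given by the action of $v^{-1}$. The coend $\mathcal L$ of $(U,V)\mapsto U^*\otimes V$ is $A^*$ with the coadjoint action $(a.f)(x)=\sum f(S(a')xa'')$ and universal dinatural family $\iota_U(\varphi\otimes u)=(a\mapsto\varphi(a.u))$. Its structure maps $\mu_{\mathcal L},\Delta_{\mathcal L},\varepsilon_{\mathcal L}$ and its Hopf pairing $\omega_{\mathcal L}$ are determined (all coherence isomorphisms being suppressed) by $$\mu_{\mathcal L}\circ(\iota_U\otimes\iota_V)=\iota_{V\otimes U}\circ(\gamma_{V,U}\otimes\mathrm{id})\circ(\mathrm{id}_{U^*}\otimes c_{U,V^*\otimes V}),\qquad \Delta_{\mathcal L}\circ\iota_U=(\iota_U\otimes\iota_U)\circ(\mathrm{id}_{U^*}\otimes\mathrm{coev}_U\otimes\mathrm{id}_U),$$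 $$\varepsilon_{\mathcal L}\circ\iota_U=\mathrm{ev}_U,\qquad \omega_{\mathcal L}\circ(\iota_U\otimes\iota_V)=(\mathrm{ev}_U\otimes\mathrm{ev}_V)\circ(\mathrm{id}_{U^*}\otimes(c_{V^*,U}\circ c_{U,V^*})\otimes\mathrm{id}_V),$$ where $c$ is the braiding and $\gamma_{V,U}:U^*\otimes V^*\to(V\otimes U)^*$ is the canonical isomorphism. $A$ is *factorisable* if $\omega_{\mathcal L}$ is non-degenerate, i.e. the morphism $\mathcal L\to\mathcal L^*$ it induces is invertible. Let $\Lambda:\mathbf 1\to\mathcal L$ be a morphism which is a two-sided integral, $\mu_{\mathcal L}\circ(\mathrm{id}\otimes\Lambda)=\Lambda\circ\varepsilon_{\mathcal L}=\mu_{\mathcal L}\circ(\Lambda\otimes\mathrm{id})$, normalised by $\omega_{\mathcal L}\circ(\Lambda\otimes\Lambda)=\mathrm{id}_{\mathbf 1}$, and let $\hat\Lambda=\Lambda(1)\in A^*$. Lyubashenko's transformations on $\mathrm{End}(\mathrm{id}_{\mathrm{Rep}\,A})$ are $\mathscr S=\psi^{-1}\circ\Omega\circ\rho\circ\psi$ and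 $\mathscr T(\varphi)=\theta\circ\varphi$, where $\psi:\mathrm{End}(\mathrm{id})\to\mathrm{Hom}(\mathcal L,\mathbf 1)$ is the isomorphism with $\psi(\varphi)\circ\iota_U=\mathrm{ev}_U\circ(\mathrm{id}\otimes\varphi_U)$, and $$\rho:\mathrm{Hom}(\mathcal L,\mathbf 1)\to\mathrm{Hom}(\mathbf 1,\mathcal L),\ \rho(r)=(r\otimes\mathrm{id})\circ\Delta_{\mathcal L}\circ\Lambda,\qquad \Omega:\mathrm{Hom}(\mathbf 1,\mathcal L)\to\mathrm{Hom}(\mathcal L,\mathbf 1),\ \Omega(s)=\omega_{\mathcal L}\circ(s\otimes\mathrm{id}).$$ Let $\xi:Z(A)\to\mathrm{End}(\mathrm{id}_{\mathrm{Rep}\,A})$ be the linear isomorphism that sends $z$ to the action of $z$, and $\mathscr S_Z=\xi^{-1}\mathscr S\xi$, $\mathscr T_Z=\xi^{-1}\mathscr T\xi$. Finally put $$D=(\mathrm{id}\otimes\mathrm{id}\otimes\Delta)(\Phi)\cdot(1\otimes\Phi^{-1})\cdot(1\otimes\beta\otimes1\otimes1),$$ $$W=(1\otimes\alpha\otimes1\otimes\alpha)\cdot(1\otimes\Phi^{-1})\cdot(1\otimes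 M\otimes1)\cdot(1\otimes\Phi)\cdot(\mathrm{id}\otimes\mathrm{id}\otimes\Delta)(\Phi^{-1}),$$ $$\hat\Delta(a\otimes b)=\sum S(D_1)\,b\,D_2\,S(D_3)\,a\,D_4,\qquad \hat\omega=\sum S(W_3)W_4\otimes S(W_1)W_2 .$$ **Theorem.** Let $A$ be a finite-dimensional ribbon quasi-Hopf algebra over $k$ that is factorisable, and let $\Lambda$ be a normalised two-sided integral of $\mathcal L$ as above. Then, for all $z\in Z(A)$, $$\mathscr S_Z(z)=\sum\Psi_1\,\beta\,S(\Psi_2)\,\hat\omega_1\,\Psi_3\;\hat\Lambda\bigl(\hat\Delta(\hat\omega_2\otimes\alpha z)\bigr),\qquad \mathscr T_Z(z)=v^{-1}z,\qquad\text{where }\Psi=\Phi^{-1}.$$ -/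

import Mathlib

open CategoryTheory MonoidalCategory Limits Opposite
open scoped TensorProduct

universe u v w

set_option linter.unusedSectionVars false

namespace QuasiHopf

section Generic

variable (C : Type u) [Category.{v} C] [MonoidalCategory C] [RightRigidCategory C]

/-- The functor `(U, V) ↦ U* ⊗ V`. -/
def dualTensor : Cᵒᵖ ⥤ C ⥤ C where
  obj U := tensorLeft ((unop U)ᘁ)
  map f := (curriedTensor C).map (f.unopᘁ)
  map_id U := by
    ext V
    simp [rightAdjointMate_id]
  map_comp f g := by
    ext V
    simp [comp_rightAdjointMate]

/-- A coend of `(U, V) ↦ U* ⊗ V`: a universal dinatural family `U* ⊗ U ⟶ L`. -/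
structure UnivCoend where
  cowedge : Cowedge (dualTensor C)
  isColimit : IsColimit cowedge

variable {C}

/-- Dinaturality of a family `U* ⊗ U ⟶ B`. -/
structure Dinatural {B : C} (φ : ∀ X : C, Xᘁ ⊗ X ⟶ B) : Prop where
  condition : ∀ ⦃X Y : C⦄ (f : X ⟶ Y), (fᘁ) ▷ X ≫ φ X = Yᘁ ◁ f ≫ φ Y

theorem Dinatural.condition_assoc {B Z : C} {φ : ∀ X : C, Xᘁ ⊗ X ⟶ B} (h : Dinatural φ)
    {X Y : C} (f : X ⟶ Y) (g : B ⟶ Z) :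
    (fᘁ) ▷ X ≫ φ X ≫ g = Yᘁ ◁ f ≫ φ Y ≫ g := by
  rw [← Category.assoc, h.condition, Category.assoc]

namespace UnivCoend

variable (L : UnivCoend C)

/-- The coend object. -/
def obj : C := L.cowedge.pt

/-- The universal dinatural family. -/
def iota (X : C) : Xᘁ ⊗ X ⟶ L.obj := L.cowedge.π X

theorem dinat : Dinatural L.iota := ⟨fun _ _ f => L.cowedge.condition f⟩

/-- The morphism out of the coend that is determined by a dinatural family. -/
def desc {B : C} (φ : ∀ X : C, Xᘁ ⊗ X ⟶ B) (h : Dinatural φ) : L.obj ⟶ B :=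
  Cowedge.IsColimit.desc L.isColimit φ (fun _ _ f => h.condition f)

@[simp]
theorem iota_desc {B : C} (φ : ∀ X : C, Xᘁ ⊗ X ⟶ B) (h : Dinatural φ) (X : C) :
    L.iota X ≫ L.desc φ h = φ X :=
  Cowedge.IsColimit.π_desc L.isColimit φ (fun _ _ f => h.condition f) X

@[simp]
theorem iota_desc_assoc {B Z : C} (φ : ∀ X : C, Xᘁ ⊗ X ⟶ B) (h : Dinatural φ) (X : C)
    (g : B ⟶ Z) : L.iota X ≫ L.desc φ h ≫ g = φ X ≫ g := by
  rw [← Category.assoc, iota_desc]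

theorem hom_ext {B : C} {f g : L.obj ⟶ B} (h : ∀ X, L.iota X ≫ f = L.iota X ≫ g) : f = g :=
  Cowedge.IsColimit.hom_ext L.isColimit h

/-- A coend from an object with a universal dinatural family. -/
def ofUniversal (P : C) (ι : ∀ X : C, Xᘁ ⊗ X ⟶ P) (hι : Dinatural ι)
    (desc : ∀ (B : C) (φ : ∀ X : C, Xᘁ ⊗ X ⟶ B), Dinatural φ → (P ⟶ B))
    (fac : ∀ (B : C) (φ : ∀ X : C, Xᘁ ⊗ X ⟶ B) (h : Dinatural φ) (X : C),
      ι X ≫ desc B φ h = φ X)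
    (uniq : ∀ (B : C) (f g : P ⟶ B), (∀ X, ι X ≫ f = ι X ≫ g) → f = g) : UnivCoend C where
  cowedge := Cowedge.mk (F := dualTensor C) P ι (fun _ _ f => hι.condition f)
  isColimit := Multicofork.IsColimit.mk _
    (fun s => desc s.pt (fun X => s.π X) ⟨fun _ _ f => Cowedge.condition s f⟩)
    (fun s X => fac s.pt (fun X => s.π X) ⟨fun _ _ f => Cowedge.condition s f⟩ X)
    (fun s _ hm => uniq _ _ _ fun X => (hm X).trans
      (fac s.pt (fun X => s.π X) ⟨fun _ _ f => Cowedge.condition s f⟩ X).symm)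

/-- Tensoring with an object on the right preserves the universal property. -/
theorem hom_ext_right (Y : C) {B : C} {f g : L.obj ⊗ Y ⟶ B}
    (h : ∀ X, L.iota X ▷ Y ≫ f = L.iota X ▷ Y ≫ g) : f = g := by
  apply (tensorRightHomEquiv L.obj Y (Yᘁ) B).injective
  apply L.hom_ext
  intro X
  apply (tensorRightHomEquiv _ Y (Yᘁ) B).symm.injective
  rw [tensorRightHomEquiv_symm_naturality, tensorRightHomEquiv_symm_naturality]
  simpa using h X

/-- Tensoring with an object on the right preserves the universal property. -/
def descRight (Y : C) {B : C} (φ : ∀ X : C, (Xᘁ ⊗ X) ⊗ Y ⟶ B)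
    (h : ∀ ⦃X X' : C⦄ (f : X ⟶ X'), (fᘁ) ▷ X ▷ Y ≫ φ X = (X'ᘁ ◁ f) ▷ Y ≫ φ X') :
    L.obj ⊗ Y ⟶ B :=
  (tensorRightHomEquiv L.obj Y (Yᘁ) B).symm
    (L.desc (fun X => tensorRightHomEquiv _ Y (Yᘁ) B (φ X)) ⟨by
      intro X X' f
      apply (tensorRightHomEquiv _ Y (Yᘁ) B).symm.injective
      rw [tensorRightHomEquiv_symm_naturality, tensorRightHomEquiv_symm_naturality]
      simpa using h f⟩)

@[simp]
theorem iota_descRight (Y : C) {B : C} (φ : ∀ X : C, (Xᘁ ⊗ X) ⊗ Y ⟶ B)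
    (h : ∀ ⦃X X' : C⦄ (f : X ⟶ X'), (fᘁ) ▷ X ▷ Y ≫ φ X = (X'ᘁ ◁ f) ▷ Y ≫ φ X') (X : C) :
    L.iota X ▷ Y ≫ L.descRight Y φ h = φ X := by
  rw [descRight, ← tensorRightHomEquiv_symm_naturality, iota_desc, Equiv.symm_apply_apply]

/-- The morphism `(U* ⊗ V*) ⊗ (V ⊗ U) ⟶ 𝟙` that evaluates `V` and then `U`. -/
def gammaTilde (V U : C) : (Uᘁ ⊗ Vᘁ) ⊗ (V ⊗ U) ⟶ 𝟙_ C :=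
  (α_ Uᘁ Vᘁ (V ⊗ U)).hom ≫ Uᘁ ◁ (α_ Vᘁ V U).inv ≫ Uᘁ ◁ (ε_ V Vᘁ) ▷ U ≫
    Uᘁ ◁ (λ_ U).hom ≫ ε_ U Uᘁ

/-- The canonical morphism `U* ⊗ V* ⟶ (V ⊗ U)*`. -/
def gammaDual (V U : C) : Uᘁ ⊗ Vᘁ ⟶ (V ⊗ U)ᘁ :=
  (ρ_ (Uᘁ ⊗ Vᘁ)).inv ≫ (Uᘁ ⊗ Vᘁ) ◁ (η_ (V ⊗ U) (V ⊗ U)ᘁ) ≫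
    (α_ (Uᘁ ⊗ Vᘁ) (V ⊗ U) (V ⊗ U)ᘁ).inv ≫ gammaTilde V U ▷ (V ⊗ U)ᘁ ≫ (λ_ (V ⊗ U)ᘁ).hom

theorem gammaTilde_left (V : C) {U U' : C} (f : U ⟶ U') :
    (fᘁ ▷ Vᘁ) ▷ (V ⊗ U) ≫ gammaTilde V U = (U'ᘁ ⊗ Vᘁ) ◁ (V ◁ f) ≫ gammaTilde V U' := by
  calc
    _ = 𝟙 _ ⊗≫ (fᘁ ▷ (Vᘁ ⊗ V ⊗ U) ≫ Uᘁ ◁ ((α_ Vᘁ V U).inv ≫ (ε_ V Vᘁ) ▷ U ≫ (λ_ U).hom)) ≫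
        ε_ U Uᘁ := by
      dsimp only [gammaTilde]; monoidal
    _ = 𝟙 _ ⊗≫ (U'ᘁ : C) ◁ ((α_ Vᘁ V U).inv ≫ (ε_ V Vᘁ) ▷ U ≫ (λ_ U).hom) ≫
        (U'ᘁ : C) ◁ f ≫ ε_ U' U'ᘁ := by
      rw [← whisker_exchange, Category.assoc, rightAdjointMate_comp_evaluation]
    _ = 𝟙 _ ⊗≫ (U'ᘁ : C) ◁ ((α_ Vᘁ V U).inv ≫ ((ε_ V Vᘁ) ▷ U ≫ 𝟙_ C ◁ f) ≫ (λ_ U').hom) ≫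
        ε_ U' U'ᘁ := by
      monoidal
    _ = _ := by
      rw [← whisker_exchange]
      dsimp only [gammaTilde]; monoidal

theorem gammaTilde_right {V V' : C} (U : C) (g : V ⟶ V') :
    (Uᘁ ◁ gᘁ) ▷ (V ⊗ U) ≫ gammaTilde V U = (Uᘁ ⊗ V'ᘁ) ◁ (g ▷ U) ≫ gammaTilde V' U := by
  calc
    _ = 𝟙 _ ⊗≫ (Uᘁ : C) ◁ (gᘁ ▷ V ≫ ε_ V Vᘁ) ▷ U ⊗≫ ε_ U Uᘁ := by
      dsimp only [gammaTilde]; monoidal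
    _ = _ := by
      rw [rightAdjointMate_comp_evaluation]
      dsimp only [gammaTilde]; monoidal

theorem gammaDual_evaluation (V U : C) :
    gammaDual V U ▷ (V ⊗ U) ≫ ε_ (V ⊗ U) (V ⊗ U)ᘁ = gammaTilde V U := by
  apply (tensorRightHomEquiv _ (V ⊗ U) ((V ⊗ U)ᘁ) _).injective
  rw [tensorRightHomEquiv_whiskerRight_comp_evaluation]
  simp [gammaDual, tensorRightHomEquiv]

theorem dual_hom_ext {W X : C} {f g : W ⟶ Xᘁ} (h : f ▷ X ≫ ε_ X Xᘁ = g ▷ X ≫ ε_ X Xᘁ) :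
    f = g := by
  have := congrArg (tensorRightHomEquiv _ X (Xᘁ) _) h
  rw [tensorRightHomEquiv_whiskerRight_comp_evaluation,
    tensorRightHomEquiv_whiskerRight_comp_evaluation] at this
  simpa using this

theorem gammaDual_left (V : C) {U U' : C} (f : U ⟶ U') :
    fᘁ ▷ Vᘁ ≫ gammaDual V U = gammaDual V U' ≫ (V ◁ f)ᘁ := by
  apply dual_hom_ext
  rw [comp_whiskerRight, comp_whiskerRight, Category.assoc, Category.assoc,
    rightAdjointMate_comp_evaluation, gammaDual_evaluation, gammaTilde_left,
    ← whisker_exchange_assoc, gammaDual_evaluation]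

theorem gammaDual_right {V V' : C} (U : C) (g : V ⟶ V') :
    Uᘁ ◁ gᘁ ≫ gammaDual V U = gammaDual V' U ≫ (g ▷ U)ᘁ := by
  apply dual_hom_ext
  rw [comp_whiskerRight, comp_whiskerRight, Category.assoc, Category.assoc,
    rightAdjointMate_comp_evaluation, gammaDual_evaluation, gammaTilde_right,
    ← whisker_exchange_assoc, gammaDual_evaluation]

theorem counit_dinatural : Dinatural (fun U : C => ε_ U Uᘁ) :=
  ⟨fun _ _ f => rightAdjointMate_comp_evaluation f⟩

variable [BraidedCategory C]

theorem hom_ext_left (Y : C) {B : C} {f g : Y ⊗ L.obj ⟶ B}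
    (h : ∀ X, Y ◁ L.iota X ≫ f = Y ◁ L.iota X ≫ g) : f = g := by
  rw [← cancel_epi (β_ L.obj Y).hom]
  apply L.hom_ext_right
  intro X
  simp [h]

/-- Dinaturality in both arguments of a family `(U* ⊗ U) ⊗ (V* ⊗ V) ⟶ B`. -/
structure Dinatural₂ {B : C} (φ : ∀ X Y : C, (Xᘁ ⊗ X) ⊗ (Yᘁ ⊗ Y) ⟶ B) : Prop where
  left : ∀ ⦃X X' : C⦄ (f : X ⟶ X') (Y : C),
    (fᘁ) ▷ X ▷ (Yᘁ ⊗ Y) ≫ φ X Y = (X'ᘁ ◁ f) ▷ (Yᘁ ⊗ Y) ≫ φ X' Y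
  right : ∀ (X : C) ⦃Y Y' : C⦄ (g : Y ⟶ Y'),
    (Xᘁ ⊗ X) ◁ (gᘁ) ▷ Y ≫ φ X Y = (Xᘁ ⊗ X) ◁ Y'ᘁ ◁ g ≫ φ X Y'

/-- `L ⊗ L` with the family `ι_U ⊗ ι_V` is a double coend: the morphism out of `L ⊗ L`
determined by a family that is dinatural in both arguments. -/
def desc₂ {B : C} (φ : ∀ X Y : C, (Xᘁ ⊗ X) ⊗ (Yᘁ ⊗ Y) ⟶ B) (h : Dinatural₂ φ) :
    L.obj ⊗ L.obj ⟶ B :=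
  (β_ L.obj L.obj).hom ≫ L.descRight L.obj
    (fun Y => (β_ L.obj (Yᘁ ⊗ Y)).inv ≫ L.descRight (Yᘁ ⊗ Y) (fun X => φ X Y)
      (fun _ _ f => h.left f Y)) (by
      intro Y Y' g
      rw [BraidedCategory.braiding_inv_naturality_left_assoc,
        BraidedCategory.braiding_inv_naturality_left_assoc]
      congr 1
      apply L.hom_ext_right
      intro X
      rw [← whisker_exchange_assoc, ← whisker_exchange_assoc]
      rw [iota_descRight, iota_descRight]
      exact h.right X g)

@[simp]
theorem iota_desc₂ {B : C} (φ : ∀ X Y : C, (Xᘁ ⊗ X) ⊗ (Yᘁ ⊗ Y) ⟶ B) (h : Dinatural₂ φ)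
    (X Y : C) : (L.iota X ⊗ₘ L.iota Y) ≫ L.desc₂ φ h = φ X Y := by
  rw [desc₂, BraidedCategory.braiding_naturality_assoc, MonoidalCategory.tensorHom_def',
    Category.assoc, iota_descRight, ← BraidedCategory.braiding_naturality_left_assoc,
    Iso.hom_inv_id_assoc, iota_descRight]

theorem hom_ext₂ {B : C} {f g : L.obj ⊗ L.obj ⟶ B}
    (h : ∀ X Y, (L.iota X ⊗ₘ L.iota Y) ≫ f = (L.iota X ⊗ₘ L.iota Y) ≫ g) : f = g := by
  apply L.hom_ext_right
  intro X
  apply L.hom_ext_left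
  intro Y
  have := h X Y
  rw [MonoidalCategory.tensorHom_def', Category.assoc, Category.assoc] at this
  exact this

section Structure

/-- The family that determines the product of the coend. -/
def mulFamily (U V : C) : (Uᘁ ⊗ U) ⊗ (Vᘁ ⊗ V) ⟶ L.obj :=
  (α_ Uᘁ U (Vᘁ ⊗ V)).hom ≫ Uᘁ ◁ (β_ U (Vᘁ ⊗ V)).hom ≫ Uᘁ ◁ (α_ Vᘁ V U).hom ≫
    (α_ Uᘁ Vᘁ (V ⊗ U)).inv ≫ gammaDual V U ▷ (V ⊗ U) ≫ L.iota (V ⊗ U)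

/-- The family that determines the coproduct of the coend. -/
def comulFamily (U : C) : Uᘁ ⊗ U ⟶ L.obj ⊗ L.obj :=
  Uᘁ ◁ (λ_ U).inv ≫ Uᘁ ◁ (η_ U Uᘁ) ▷ U ≫ Uᘁ ◁ (α_ U Uᘁ U).hom ≫
    (α_ Uᘁ U (Uᘁ ⊗ U)).inv ≫ (L.iota U ⊗ₘ L.iota U)

/-- The family that determines the Hopf pairing of the coend. -/
def pairingFamily (U V : C) : (Uᘁ ⊗ U) ⊗ (Vᘁ ⊗ V) ⟶ 𝟙_ C :=
  (α_ Uᘁ U (Vᘁ ⊗ V)).hom ≫ Uᘁ ◁ (α_ U Vᘁ V).inv ≫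
    Uᘁ ◁ ((β_ U Vᘁ).hom ≫ (β_ Vᘁ U).hom) ▷ V ≫ Uᘁ ◁ (α_ U Vᘁ V).hom ≫
    Uᘁ ◁ U ◁ (ε_ V Vᘁ) ≫ Uᘁ ◁ (ρ_ U).hom ≫ ε_ U Uᘁ

theorem comul_dinatural : Dinatural L.comulFamily := ⟨by
  intro U U' f
  calc
    _ = 𝟙 _ ⊗≫ (fᘁ ▷ (𝟙_ C ⊗ U) ≫ (Uᘁ : C) ◁ (η_ U Uᘁ ▷ U)) ⊗≫
        L.iota U ▷ (Uᘁ ⊗ U) ≫ L.obj ◁ L.iota U := by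
      dsimp only [comulFamily]
      rw [MonoidalCategory.tensorHom_def]
      monoidal
    _ = 𝟙 _ ⊗≫ ((U'ᘁ : C) ◁ η_ U Uᘁ) ▷ U ⊗≫ (fᘁ ▷ U ≫ L.iota U) ▷ (Uᘁ ⊗ U) ≫
        L.obj ◁ L.iota U := by
      rw [← whisker_exchange]
      monoidal
    _ = 𝟙 _ ⊗≫ ((U'ᘁ : C) ◁ (η_ U Uᘁ ≫ f ▷ Uᘁ)) ▷ U ⊗≫
        (L.iota U' ▷ (Uᘁ ⊗ U) ≫ L.obj ◁ L.iota U) := by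
      rw [L.dinat.condition]; monoidal
    _ = 𝟙 _ ⊗≫ ((U'ᘁ : C) ◁ η_ U' U'ᘁ) ▷ U ⊗≫ (U'ᘁ ⊗ U') ◁ (fᘁ ▷ U ≫ L.iota U) ⊗≫
        L.iota U' ▷ L.obj := by
      rw [← coevaluation_comp_rightAdjointMate, ← whisker_exchange]; monoidal
    _ = 𝟙 _ ⊗≫ (U'ᘁ : C) ◁ (η_ U' U'ᘁ ▷ U ≫ (U' ⊗ U'ᘁ) ◁ f) ⊗≫ (U'ᘁ ⊗ U') ◁ L.iota U' ⊗≫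
        L.iota U' ▷ L.obj := by
      rw [L.dinat.condition]; monoidal
    _ = _ := by
      rw [← whisker_exchange]
      dsimp only [comulFamily]
      rw [MonoidalCategory.tensorHom_def']
      monoidal⟩

theorem monodromy_left {U U' : C} (f : U ⟶ U') (V : C) :
    f ▷ (Vᘁ ⊗ V) ≫ (α_ U' Vᘁ V).inv ≫ ((β_ U' Vᘁ).hom ≫ (β_ Vᘁ U').hom) ▷ V ≫
      (α_ U' Vᘁ V).hom =
    (α_ U Vᘁ V).inv ≫ ((β_ U Vᘁ).hom ≫ (β_ Vᘁ U).hom) ▷ V ≫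
      (α_ U Vᘁ V).hom ≫ f ▷ (Vᘁ ⊗ V) := by
  calc
    _ = 𝟙 _ ⊗≫ (f ▷ Vᘁ ≫ (β_ U' Vᘁ).hom ≫ (β_ Vᘁ U').hom) ▷ V ⊗≫ 𝟙 _ := by monoidal
    _ = _ := by
      rw [BraidedCategory.braiding_naturality_left_assoc,
        BraidedCategory.braiding_naturality_right]
      monoidal

theorem monodromy_right (U : C) {V V' : C} (g : V ⟶ V') :
    U ◁ gᘁ ▷ V ≫ (α_ U Vᘁ V).inv ≫ ((β_ U Vᘁ).hom ≫ (β_ Vᘁ U).hom) ▷ V ≫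
      (α_ U Vᘁ V).hom =
    (α_ U V'ᘁ V).inv ≫ ((β_ U V'ᘁ).hom ≫ (β_ V'ᘁ U).hom) ▷ V ≫
      (α_ U V'ᘁ V).hom ≫ U ◁ gᘁ ▷ V := by
  calc
    _ = 𝟙 _ ⊗≫ (U ◁ gᘁ ≫ (β_ U Vᘁ).hom ≫ (β_ Vᘁ U).hom) ▷ V ⊗≫ 𝟙 _ := by monoidal
    _ = _ := by
      rw [BraidedCategory.braiding_naturality_right_assoc,
        BraidedCategory.braiding_naturality_left]
      monoidal

theorem pairing_dinatural : Dinatural₂ (pairingFamily (C := C)) where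
  left U U' f V := by
    calc
      _ = 𝟙 _ ⊗≫ (fᘁ ▷ (U ⊗ (Vᘁ ⊗ V)) ≫ (Uᘁ : C) ◁ ((α_ U Vᘁ V).inv ≫
          ((β_ U Vᘁ).hom ≫ (β_ Vᘁ U).hom) ▷ V ≫ (α_ U Vᘁ V).hom ≫ U ◁ (ε_ V Vᘁ) ≫
          (ρ_ U).hom)) ≫ ε_ U Uᘁ := by
        dsimp only [pairingFamily]; monoidal
      _ = 𝟙 _ ⊗≫ (U'ᘁ : C) ◁ ((α_ U Vᘁ V).inv ≫
          ((β_ U Vᘁ).hom ≫ (β_ Vᘁ U).hom) ▷ V ≫ (α_ U Vᘁ V).hom ≫ (U ◁ (ε_ V Vᘁ) ≫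
          f ▷ (𝟙_ C)) ≫ (ρ_ U').hom) ≫ ε_ U' U'ᘁ := by
        rw [← whisker_exchange, Category.assoc, rightAdjointMate_comp_evaluation]
        monoidal
      _ = 𝟙 _ ⊗≫ (U'ᘁ : C) ◁ (((α_ U Vᘁ V).inv ≫
          ((β_ U Vᘁ).hom ≫ (β_ Vᘁ U).hom) ▷ V ≫ (α_ U Vᘁ V).hom ≫ f ▷ (Vᘁ ⊗ V)) ≫
          U' ◁ (ε_ V Vᘁ) ≫ (ρ_ U').hom) ≫ ε_ U' U'ᘁ := by
        rw [whisker_exchange]; monoidal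
      _ = _ := by
        rw [← monodromy_left]
        dsimp only [pairingFamily]; monoidal
  right U V V' g := by
    calc
      _ = 𝟙 _ ⊗≫ (Uᘁ : C) ◁ ((U ◁ gᘁ ▷ V ≫ (α_ U Vᘁ V).inv ≫
          ((β_ U Vᘁ).hom ≫ (β_ Vᘁ U).hom) ▷ V ≫ (α_ U Vᘁ V).hom) ≫ U ◁ (ε_ V Vᘁ) ≫
          (ρ_ U).hom) ≫ ε_ U Uᘁ := by
        dsimp only [pairingFamily]; monoidal
      _ = 𝟙 _ ⊗≫ (Uᘁ : C) ◁ ((α_ U V'ᘁ V).inv ≫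
          ((β_ U V'ᘁ).hom ≫ (β_ V'ᘁ U).hom) ▷ V ≫ (α_ U V'ᘁ V).hom ≫
          U ◁ (gᘁ ▷ V ≫ ε_ V Vᘁ) ≫ (ρ_ U).hom) ≫ ε_ U Uᘁ := by
        rw [monodromy_right]; monoidal
      _ = 𝟙 _ ⊗≫ (Uᘁ : C) ◁ ((((β_ U V'ᘁ).hom ≫ (β_ V'ᘁ U).hom) ▷ V ≫ (U ⊗ V'ᘁ) ◁ g) ≫
          (α_ U V'ᘁ V').hom ≫ U ◁ ε_ V' V'ᘁ ≫ (ρ_ U).hom) ≫ ε_ U Uᘁ := by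
        rw [rightAdjointMate_comp_evaluation]; monoidal
      _ = _ := by
        rw [← whisker_exchange]
        dsimp only [pairingFamily]; monoidal

theorem mul_dinatural : Dinatural₂ L.mulFamily where
  left U U' f V := by
    calc
      _ = 𝟙 _ ⊗≫ (fᘁ ▷ (U ⊗ (Vᘁ ⊗ V)) ≫ (Uᘁ : C) ◁ ((β_ U (Vᘁ ⊗ V)).hom ≫
          (α_ Vᘁ V U).hom)) ⊗≫ gammaDual V U ▷ (V ⊗ U) ≫ L.iota (V ⊗ U) := by
        dsimp only [mulFamily]; monoidal
      _ = 𝟙 _ ⊗≫ (U'ᘁ : C) ◁ ((β_ U (Vᘁ ⊗ V)).hom ≫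
          (α_ Vᘁ V U).hom) ⊗≫ (fᘁ ▷ Vᘁ ≫ gammaDual V U) ▷ (V ⊗ U) ≫ L.iota (V ⊗ U) := by
        rw [← whisker_exchange]; monoidal
      _ = 𝟙 _ ⊗≫ (U'ᘁ : C) ◁ ((β_ U (Vᘁ ⊗ V)).hom ≫
          (α_ Vᘁ V U).hom) ⊗≫ (gammaDual V U' ▷ (V ⊗ U) ≫ (V ⊗ U')ᘁ ◁ (V ◁ f)) ≫
          L.iota (V ⊗ U') := by
        rw [gammaDual_left, comp_whiskerRight, Category.assoc, L.dinat.condition,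
          Category.assoc]
      _ = 𝟙 _ ⊗≫ (U'ᘁ : C) ◁ ((β_ U (Vᘁ ⊗ V)).hom ≫ (Vᘁ ⊗ V) ◁ f) ⊗≫
          gammaDual V U' ▷ (V ⊗ U') ≫ L.iota (V ⊗ U') := by
        rw [← whisker_exchange]; monoidal
      _ = _ := by
        rw [← BraidedCategory.braiding_naturality_left]
        dsimp only [mulFamily]; monoidal
  right U V V' g := by
    calc
      _ = 𝟙 _ ⊗≫ (Uᘁ : C) ◁ (U ◁ (gᘁ ▷ V) ≫ (β_ U (Vᘁ ⊗ V)).hom ≫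
          (α_ Vᘁ V U).hom) ⊗≫ gammaDual V U ▷ (V ⊗ U) ≫ L.iota (V ⊗ U) := by
        dsimp only [mulFamily]; monoidal
      _ = 𝟙 _ ⊗≫ (Uᘁ : C) ◁ ((β_ U (V'ᘁ ⊗ V)).hom ≫ (α_ V'ᘁ V U).hom) ⊗≫
          (Uᘁ ◁ gᘁ ≫ gammaDual V U) ▷ (V ⊗ U) ≫ L.iota (V ⊗ U) := by
        rw [BraidedCategory.braiding_naturality_right_assoc]; monoidal
      _ = 𝟙 _ ⊗≫ (Uᘁ : C) ◁ ((β_ U (V'ᘁ ⊗ V)).hom ≫ (α_ V'ᘁ V U).hom) ⊗≫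
          (gammaDual V' U ▷ (V ⊗ U) ≫ (V' ⊗ U)ᘁ ◁ (g ▷ U)) ≫ L.iota (V' ⊗ U) := by
        rw [gammaDual_right, comp_whiskerRight, Category.assoc, L.dinat.condition,
          Category.assoc]
      _ = 𝟙 _ ⊗≫ (Uᘁ : C) ◁ ((β_ U (V'ᘁ ⊗ V)).hom ≫ (V'ᘁ ◁ g) ▷ U) ⊗≫
          gammaDual V' U ▷ (V' ⊗ U) ≫ L.iota (V' ⊗ U) := by
        rw [← whisker_exchange]; monoidal
      _ = _ := by
        rw [← BraidedCategory.braiding_naturality_right]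
        dsimp only [mulFamily]; monoidal

/-- The product `μ : L ⊗ L ⟶ L`. -/
def mul : L.obj ⊗ L.obj ⟶ L.obj := L.desc₂ L.mulFamily L.mul_dinatural

/-- The coproduct `Δ : L ⟶ L ⊗ L`. -/
def comul : L.obj ⟶ L.obj ⊗ L.obj := L.desc L.comulFamily L.comul_dinatural

/-- The counit `ε : L ⟶ 𝟙`. -/
def counit : L.obj ⟶ 𝟙_ C := L.desc (fun U => ε_ U Uᘁ) counit_dinatural

/-- The Hopf pairing `ω : L ⊗ L ⟶ 𝟙`. -/
def pairing : L.obj ⊗ L.obj ⟶ 𝟙_ C := L.desc₂ pairingFamily pairing_dinatural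

/-- The morphism `L ⟶ L*` induced by the Hopf pairing. -/
def pairingMap : L.obj ⟶ L.objᘁ :=
  (ρ_ L.obj).inv ≫ L.obj ◁ (η_ L.obj L.objᘁ) ≫ (α_ L.obj L.obj L.objᘁ).inv ≫
    L.pairing ▷ L.objᘁ ≫ (λ_ L.objᘁ).hom

/-- Two-sided integrals `Λ : 𝟙 ⟶ L`. -/
structure IsIntegral (Λ : 𝟙_ C ⟶ L.obj) : Prop where
  left : (ρ_ L.obj).inv ≫ L.obj ◁ Λ ≫ L.mul = L.counit ≫ Λ
  right : (λ_ L.obj).inv ≫ Λ ▷ L.obj ≫ L.mul = L.counit ≫ Λ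

/-- The normalisation `ω ∘ (Λ ⊗ Λ) = id`. -/
def IsNormalised (Λ : 𝟙_ C ⟶ L.obj) : Prop :=
  (λ_ (𝟙_ C)).inv ≫ (Λ ⊗ₘ Λ) ≫ L.pairing = 𝟙 (𝟙_ C)

end Structure

section Modular

variable (k : Type w) [Field k] [Preadditive C] [Linear k C] [MonoidalPreadditive C]
  [MonoidalLinear k C]

/-- `ψ(α)` is determined by `ψ(α) ∘ ι_X = ev_X ∘ (id ⊗ α_X)`. -/
def psi (α : CatCenter C) : L.obj ⟶ 𝟙_ C :=
  L.desc (fun X => Xᘁ ◁ α.app X ≫ ε_ X Xᘁ) ⟨by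
    intro X Y f
    rw [← whisker_exchange_assoc, rightAdjointMate_comp_evaluation, ← whiskerLeft_comp_assoc,
      ← whiskerLeft_comp_assoc, α.naturality]⟩

/-- The component at `X` of the natural endomorphism of the identity that corresponds to
`f : L ⟶ 𝟙`. -/
def psiInvApp (f : L.obj ⟶ 𝟙_ C) (X : C) : X ⟶ X :=
  (λ_ X).inv ≫ η_ X Xᘁ ▷ X ≫ (α_ X Xᘁ X).hom ≫ X ◁ L.iota X ≫ X ◁ f ≫ (ρ_ X).hom

theorem psiInvApp_naturality (f : L.obj ⟶ 𝟙_ C) {X Y : C} (g : X ⟶ Y) :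
    g ≫ L.psiInvApp f Y = L.psiInvApp f X ≫ g := by
  calc
    _ = 𝟙 _ ⊗≫ (𝟙_ C ◁ g ≫ η_ Y Yᘁ ▷ Y) ⊗≫ Y ◁ (L.iota Y ≫ f) ⊗≫ 𝟙 _ := by
      dsimp only [psiInvApp]; monoidal
    _ = 𝟙 _ ⊗≫ η_ Y Yᘁ ▷ X ⊗≫ Y ◁ ((Yᘁ : C) ◁ g ≫ L.iota Y ≫ f) ⊗≫ 𝟙 _ := by
      rw [whisker_exchange]; monoidal
    _ = 𝟙 _ ⊗≫ (η_ Y Yᘁ ≫ Y ◁ (rightAdjointMate g)) ▷ X ⊗≫ Y ◁ (L.iota X ≫ f) ⊗≫ 𝟙 _ := by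
      rw [← L.dinat.condition_assoc]; monoidal
    _ = 𝟙 _ ⊗≫ η_ X Xᘁ ▷ X ⊗≫ (g ▷ (Xᘁ ⊗ X) ≫ Y ◁ (L.iota X ≫ f)) ⊗≫ 𝟙 _ := by
      rw [coevaluation_comp_rightAdjointMate]; monoidal
    _ = _ := by
      rw [← whisker_exchange]
      dsimp only [psiInvApp]; monoidal

theorem iota_psi (α : CatCenter C) (X : C) :
    L.iota X ≫ L.psi α = Xᘁ ◁ α.app X ≫ ε_ X Xᘁ :=
  L.iota_desc _ _ X

theorem psiInvApp_psi (α : CatCenter C) (X : C) : L.psiInvApp (L.psi α) X = α.app X := by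
  calc
    _ = 𝟙 _ ⊗≫ (η_ X Xᘁ ▷ X ≫ (X ⊗ Xᘁ) ◁ α.app X) ⊗≫ X ◁ ε_ X Xᘁ ⊗≫ 𝟙 _ := by
      dsimp only [psiInvApp]
      rw [← whiskerLeft_comp_assoc X (L.iota X), iota_psi]
      monoidal
    _ = α.app X ⊗≫ (η_ X Xᘁ ▷ X ⊗≫ X ◁ ε_ X Xᘁ) ⊗≫ 𝟙 _ := by
      rw [← whisker_exchange]; monoidal
    _ = _ := by
      rw [ExactPairing.evaluation_coevaluation'']; monoidal

theorem evaluation_psiInvApp (f : L.obj ⟶ 𝟙_ C) (X : C) :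
    Xᘁ ◁ L.psiInvApp f X ≫ ε_ X Xᘁ = L.iota X ≫ f := by
  calc
    _ = 𝟙 _ ⊗≫ (Xᘁ : C) ◁ η_ X Xᘁ ▷ X ⊗≫
        ((Xᘁ ⊗ X) ◁ (L.iota X ≫ f) ≫ ε_ X Xᘁ ▷ 𝟙_ C) ⊗≫ 𝟙 _ := by
      dsimp only [psiInvApp]; monoidal
    _ = 𝟙 _ ⊗≫ ((Xᘁ : C) ◁ η_ X Xᘁ ⊗≫ ε_ X Xᘁ ▷ (Xᘁ : C)) ▷ X ⊗≫ (L.iota X ≫ f) := by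
      rw [whisker_exchange]; monoidal
    _ = _ := by
      rw [ExactPairing.coevaluation_evaluation'']; monoidal

/-- The isomorphism `ψ : End(id) ⟶ Hom(L, 𝟙)`, with its explicit inverse. -/
def psiEquiv : CatCenter C ≃ₗ[k] (L.obj ⟶ 𝟙_ C) where
  toFun α := L.psi α
  map_add' α β := by
    apply L.hom_ext
    intro X
    have h : (α + β).app X = α.app X + β.app X := rfl
    rw [Preadditive.comp_add, iota_psi, iota_psi, iota_psi, h]
    simp
  map_smul' c α := by
    apply L.hom_ext
    intro X
    have h : (c • α).app X = c • α.app X := rfl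
    rw [RingHom.id_apply, Linear.comp_smul, iota_psi, iota_psi, h]
    simp
  invFun f :=
    { app := fun X => L.psiInvApp f X
      naturality := fun _ _ g => L.psiInvApp_naturality f g }
  left_inv α := NatTrans.ext (funext fun X => L.psiInvApp_psi α X)
  right_inv f := L.hom_ext fun X => (L.iota_psi _ X).trans (L.evaluation_psiInvApp f X)

/-- `ρ(f) = (f ⊗ id) ∘ Δ ∘ Λ`. -/
def rho (Λ : 𝟙_ C ⟶ L.obj) : (L.obj ⟶ 𝟙_ C) →ₗ[k] (𝟙_ C ⟶ L.obj) where
  toFun f := Λ ≫ L.comul ≫ f ▷ L.obj ≫ (λ_ L.obj).hom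
  map_add' f g := by simp
  map_smul' c f := by simp

/-- `Ω(a) = ω ∘ (a ⊗ id)`. -/
def Omega : (𝟙_ C ⟶ L.obj) →ₗ[k] (L.obj ⟶ 𝟙_ C) where
  toFun a := (λ_ L.obj).inv ≫ a ▷ L.obj ≫ L.pairing
  map_add' f g := by simp
  map_smul' c f := by simp

/-- The `S`-transformation on `End(id)`, namely `ψ⁻¹ ∘ Ω ∘ ρ ∘ ψ`. -/
def modularS (Λ : 𝟙_ C ⟶ L.obj) : CatCenter C →ₗ[k] CatCenter C :=
  (L.psiEquiv k).symm.toLinearMap ∘ₗ L.Omega k ∘ₗ L.rho k Λ ∘ₗ (L.psiEquiv k).toLinearMap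

end Modular
end UnivCoend

/-- A ribbon twist on a braided category with duals. -/
class RibbonTwist (C : Type u) [Category.{v} C] [MonoidalCategory C] [RightRigidCategory C]
    [BraidedCategory C] where
  /-- The twist, a natural automorphism of the identity functor. -/
  twist : (CatCenter C)ˣ
  twist_tensor : ∀ U V : C, twist.val.app (U ⊗ V) =
    (β_ U V).hom ≫ (β_ V U).hom ≫ (twist.val.app U ⊗ₘ twist.val.app V)
  twist_dual : ∀ U : C, twist.val.app Uᘁ = (twist.val.app U)ᘁ

/-- The `T`-transformation on `End(id)`: composition with the ribbon twist. -/
def modularT (k : Type w) [Field k] [Preadditive C] [Linear k C] [BraidedCategory C]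
    [RibbonTwist C] : CatCenter C →ₗ[k] CatCenter C :=
  LinearMap.mulLeft k ((RibbonTwist.twist (C := C) : (CatCenter C)ˣ) : CatCenter C)

/-- Factorisability: the Hopf pairing on the coend is non-degenerate. -/
def IsFactorisable (C : Type u) [Category.{v} C] [MonoidalCategory C] [RightRigidCategory C]
    [BraidedCategory C] : Prop :=
  ∃ L : UnivCoend C, IsIso L.pairingMap

end Generic

section Legs

variable {k : Type u} {A : Type v} [Field k] [Ring A] [Algebra k A]

/-- `x ⊗ y ↦ Δ(x) ⊗ y`. -/
def comulFirst (Δ : A →ₐ[k] A ⊗[k] A) (B : Type w) [Ring B] [Algebra k B] :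
    A ⊗[k] B →ₐ[k] A ⊗[k] (A ⊗[k] B) :=
  (Algebra.TensorProduct.assoc k k k A A B).toAlgHom.comp
    (Algebra.TensorProduct.map Δ (AlgHom.id k B))

/-- `x ⊗ y ↦ x ⊗ f(y)`. -/
def applySecond {B C : Type*} [Ring B] [Algebra k B] [Ring C] [Algebra k C] (f : B →ₐ[k] C) :
    A ⊗[k] B →ₐ[k] A ⊗[k] C :=
  Algebra.TensorProduct.map (AlgHom.id k A) f

variable (k A)

/-- `x ⊗ y ↦ y ⊗ x`. -/
def tensorFlip : A ⊗[k] A ≃ₐ[k] A ⊗[k] A := Algebra.TensorProduct.comm k A A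

/-- `x ↦ x ⊗ 1`. -/
def leg₁ : A →ₐ[k] A ⊗[k] A := Algebra.TensorProduct.includeLeft

/-- `x ↦ 1 ⊗ x`. -/
def oneTensor (B : Type w) [Ring B] [Algebra k B] : B →ₐ[k] A ⊗[k] B :=
  Algebra.TensorProduct.includeRight

/-- `x ⊗ y ↦ x ⊗ y ⊗ 1`. -/
def leg₁₂ : A ⊗[k] A →ₐ[k] A ⊗[k] (A ⊗[k] A) := applySecond (leg₁ k A)

/-- `x ⊗ y ↦ x ⊗ 1 ⊗ y`. -/
def leg₁₃ : A ⊗[k] A →ₐ[k] A ⊗[k] (A ⊗[k] A) := applySecond (oneTensor k A A)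

/-- `x ⊗ y ↦ 1 ⊗ x ⊗ y`. -/
def leg₂₃ : A ⊗[k] A →ₐ[k] A ⊗[k] (A ⊗[k] A) := oneTensor k A (A ⊗[k] A)

/-- `x ⊗ y ⊗ z ↦ x ⊗ y ⊗ z ⊗ 1`. -/
def leg₁₂₃ : A ⊗[k] (A ⊗[k] A) →ₐ[k] A ⊗[k] (A ⊗[k] (A ⊗[k] A)) := applySecond (leg₁₂ k A)

/-- `x ⊗ y ⊗ z ↦ 1 ⊗ x ⊗ y ⊗ z`. -/
def leg₂₃₄ : A ⊗[k] (A ⊗[k] A) →ₐ[k] A ⊗[k] (A ⊗[k] (A ⊗[k] A)) :=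
  oneTensor k A (A ⊗[k] (A ⊗[k] A))

/-- `x₁ ⊗ x₂ ⊗ x₃ ↦ x₂ ⊗ x₃ ⊗ x₁`. -/
def perm₂₃₁ : A ⊗[k] (A ⊗[k] A) ≃ₐ[k] A ⊗[k] (A ⊗[k] A) :=
  (Algebra.TensorProduct.comm k A (A ⊗[k] A)).trans (Algebra.TensorProduct.assoc k k k A A A)

/-- `x₁ ⊗ x₂ ⊗ x₃ ↦ x₃ ⊗ x₁ ⊗ x₂`. -/
def perm₃₁₂ : A ⊗[k] (A ⊗[k] A) ≃ₐ[k] A ⊗[k] (A ⊗[k] A) := (perm₂₃₁ k A).symm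

/-- `x₁ ⊗ x₂ ⊗ x₃ ↦ x₁ ⊗ x₃ ⊗ x₂`. -/
def perm₁₃₂ : A ⊗[k] (A ⊗[k] A) ≃ₐ[k] A ⊗[k] (A ⊗[k] A) :=
  Algebra.TensorProduct.congr AlgEquiv.refl (tensorFlip k A)

/-- `x₁ ⊗ x₂ ⊗ x₃ ↦ x₂ ⊗ x₁ ⊗ x₃`. -/
def perm₂₁₃ : A ⊗[k] (A ⊗[k] A) ≃ₐ[k] A ⊗[k] (A ⊗[k] A) :=
  Algebra.TensorProduct.leftComm k A A A

variable {k A}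

/-- `x ⊗ y ↦ S(x) α y`. -/
def antipodeLeft (S : A →ₗ[k] A) (α : A) : A ⊗[k] A →ₗ[k] A :=
  LinearMap.mul' k A ∘ₗ TensorProduct.map (LinearMap.mulRight k α ∘ₗ S) LinearMap.id

/-- `x ⊗ y ↦ x β S(y)`. -/
def antipodeRight (S : A →ₗ[k] A) (β : A) : A ⊗[k] A →ₗ[k] A :=
  LinearMap.mul' k A ∘ₗ TensorProduct.map (LinearMap.mulRight k β) S

/-- `x ⊗ y ⊗ z ↦ S(x) α y β S(z)`. -/
def zigzagLeft (S : A →ₗ[k] A) (α β : A) : A ⊗[k] (A ⊗[k] A) →ₗ[k] A :=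
  LinearMap.mul' k A ∘ₗ
    TensorProduct.map (LinearMap.mulRight k α ∘ₗ S) (antipodeRight S β)

/-- `x ⊗ y ⊗ z ↦ x β S(y) α z`. -/
def zigzagRight (S : A →ₗ[k] A) (α β : A) : A ⊗[k] (A ⊗[k] A) →ₗ[k] A :=
  LinearMap.mul' k A ∘ₗ
    TensorProduct.map (LinearMap.mulRight k β) (antipodeLeft S α)

@[simp]
theorem comulFirst_assoc_symm (Δ : A →ₐ[k] A ⊗[k] A) (B : Type w) [Ring B] [Algebra k B] (x : A)
    (y : B) : (Algebra.TensorProduct.assoc k k k A A B).symm (comulFirst Δ B (x ⊗ₜ y)) =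
      Δ x ⊗ₜ y := by
  simp [comulFirst]

@[simp]
theorem applySecond_tmul {B C : Type*} [Ring B] [Algebra k B] [Ring C] [Algebra k C]
    (f : B →ₐ[k] C) (x : A) (y : B) : applySecond (A := A) f (x ⊗ₜ y) = x ⊗ₜ f y := rfl

@[simp]
theorem tensorFlip_tmul (x y : A) : tensorFlip k A (x ⊗ₜ y) = y ⊗ₜ x := rfl

@[simp]
theorem leg₁₂_tmul (x y : A) : leg₁₂ k A (x ⊗ₜ y) = x ⊗ₜ (y ⊗ₜ 1) := rfl

@[simp]
theorem leg₁₃_tmul (x y : A) : leg₁₃ k A (x ⊗ₜ y) = x ⊗ₜ (1 ⊗ₜ y) := rfl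

@[simp]
theorem leg₂₃_tmul (x y : A) : leg₂₃ k A (x ⊗ₜ y) = 1 ⊗ₜ (x ⊗ₜ y) := rfl

@[simp]
theorem leg₁₂₃_tmul (x y z : A) :
    leg₁₂₃ k A (x ⊗ₜ (y ⊗ₜ z)) = x ⊗ₜ (y ⊗ₜ (z ⊗ₜ 1)) := rfl

@[simp]
theorem leg₂₃₄_tmul (x y z : A) :
    leg₂₃₄ k A (x ⊗ₜ (y ⊗ₜ z)) = 1 ⊗ₜ (x ⊗ₜ (y ⊗ₜ z)) := rfl

@[simp]
theorem perm₂₃₁_tmul (x y z : A) : perm₂₃₁ k A (x ⊗ₜ (y ⊗ₜ z)) = y ⊗ₜ (z ⊗ₜ x) := rfl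

@[simp]
theorem perm₃₁₂_tmul (x y z : A) : perm₃₁₂ k A (x ⊗ₜ (y ⊗ₜ z)) = z ⊗ₜ (x ⊗ₜ y) := rfl

@[simp]
theorem perm₁₃₂_tmul (x y z : A) : perm₁₃₂ k A (x ⊗ₜ (y ⊗ₜ z)) = x ⊗ₜ (z ⊗ₜ y) := rfl

@[simp]
theorem perm₂₁₃_tmul (x y z : A) : perm₂₁₃ k A (x ⊗ₜ (y ⊗ₜ z)) = y ⊗ₜ (x ⊗ₜ z) := rfl

@[simp]
theorem antipodeLeft_tmul (S : A →ₗ[k] A) (α x y : A) :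
    antipodeLeft S α (x ⊗ₜ y) = S x * α * y := rfl

@[simp]
theorem antipodeRight_tmul (S : A →ₗ[k] A) (β x y : A) :
    antipodeRight S β (x ⊗ₜ y) = x * β * S y := rfl

@[simp]
theorem zigzagLeft_tmul (S : A →ₗ[k] A) (α β x y z : A) :
    zigzagLeft S α β (x ⊗ₜ (y ⊗ₜ z)) = S x * α * (y * β * S z) := rfl

@[simp]
theorem zigzagRight_tmul (S : A →ₗ[k] A) (α β x y z : A) :
    zigzagRight S α β (x ⊗ₜ (y ⊗ₜ z)) = x * β * (S y * α * z) := rfl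

end Legs

/-- Quasi-Hopf algebras. -/
class QuasiHopfAlgebra (k : Type u) (A : Type v) [Field k] [Ring A] [Algebra k A] where
  /-- The coproduct `Δ`. -/
  comul : A →ₐ[k] A ⊗[k] A
  /-- The counit `ε`. -/
  counit : A →ₐ[k] k
  /-- The coassociator `Φ`. -/
  assoc : (A ⊗[k] (A ⊗[k] A))ˣ
  /-- The antipode `S`. -/
  antipode : A →ₗ[k] A
  /-- The evaluation element `α`. -/
  alpha : A
  /-- The coevaluation element `β`. -/
  beta : A
  counit_comul : ∀ a, TensorProduct.lid k A (TensorProduct.map counit.toLinearMap .id (comul a)) = a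
  comul_counit : ∀ a, TensorProduct.rid k A (TensorProduct.map .id counit.toLinearMap (comul a)) = a
  coassoc : ∀ a, comulFirst comul A (comul a) * assoc.val = assoc.val * applySecond comul (comul a)
  assoc_counit : TensorProduct.map .id
    (TensorProduct.lid k A ∘ₗ TensorProduct.map counit.toLinearMap .id) assoc.val =
      (1 : A ⊗[k] A)
  pentagon : comulFirst comul (A ⊗[k] A) assoc.val * applySecond (applySecond comul) assoc.val =
    leg₁₂₃ k A assoc.val * applySecond (comulFirst comul A) assoc.val * leg₂₃₄ k A assoc.val
  antipode_one : antipode 1 = 1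
  antipode_mul : ∀ a b, antipode (a * b) = antipode b * antipode a
  antipode_alpha : ∀ a, antipodeLeft antipode alpha (comul a) = counit a • alpha
  antipode_beta : ∀ a, antipodeRight antipode beta (comul a) = counit a • beta
  zigzag_left : zigzagLeft antipode alpha beta assoc.val = 1
  zigzag_right : zigzagRight antipode alpha beta assoc.inv = 1

/-- Quasi-triangular quasi-Hopf algebras. -/
class QuasiTriangularQuasiHopfAlgebra (k : Type u) (A : Type v) [Field k] [Ring A] [Algebra k A]
    extends QuasiHopfAlgebra k A where
  /-- The universal R-matrix `R`. -/
  rMatrix : (A ⊗[k] A)ˣ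
  rMatrix_comul : ∀ a, rMatrix.val * comul a = tensorFlip k A (comul a) * rMatrix.val
  hexagon_left : comulFirst comul A rMatrix.val =
    perm₂₃₁ k A assoc.inv * leg₁₃ k A rMatrix.val * perm₁₃₂ k A assoc.val *
      leg₂₃ k A rMatrix.val * assoc.inv
  hexagon_right : applySecond comul rMatrix.val =
    perm₃₁₂ k A assoc.val * leg₁₃ k A rMatrix.val * perm₂₁₃ k A assoc.inv *
      leg₁₂ k A rMatrix.val * assoc.val

/-- The monodromy element `M = R₂₁ R`. -/
def monodromy (k : Type u) (A : Type v) [Field k] [Ring A] [Algebra k A]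
    [QuasiTriangularQuasiHopfAlgebra k A] : (A ⊗[k] A)ˣ :=
  Units.map (tensorFlip k A).toMonoidHom QuasiTriangularQuasiHopfAlgebra.rMatrix *
    QuasiTriangularQuasiHopfAlgebra.rMatrix

/-- Ribbon quasi-Hopf algebras. -/
class RibbonQuasiHopfAlgebra (k : Type u) (A : Type v) [Field k] [Ring A] [Algebra k A]
    extends QuasiTriangularQuasiHopfAlgebra k A where
  /-- The ribbon element `v`. -/
  ribbon : A
  ribbon_ne_zero : ribbon ≠ 0
  ribbon_central : ∀ a, ribbon * a = a * ribbon
  ribbon_comul : (monodromy k A).val * comul ribbon = ribbon ⊗ₜ ribbon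
  antipode_ribbon : antipode ribbon = ribbon

section Actions

variable {k : Type u} [Field k]

/-- The action of `A ⊗ B` on `V ⊗ W` obtained from actions of `A` on `V` and of `B` on `W`. -/
def tensorAct {A B V W : Type*} [Ring A] [Algebra k A] [Ring B] [Algebra k B] [AddCommGroup V]
    [Module k V] [AddCommGroup W] [Module k W] (f : A →ₐ[k] Module.End k V)
    (g : B →ₐ[k] Module.End k W) : A ⊗[k] B →ₐ[k] Module.End k (V ⊗[k] W) :=
  (Module.endTensorEndAlgHom (R := k) (S := k) (A := k) (M := V) (N := W)).comp
    (Algebra.TensorProduct.map f g)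

section

variable {A B D V W X : Type*} [Ring A] [Algebra k A] [Ring B] [Algebra k B] [Ring D] [Algebra k D]
  [AddCommGroup V] [Module k V] [AddCommGroup W] [Module k W] [AddCommGroup X] [Module k X]
  (f : A →ₐ[k] Module.End k V) (g : B →ₐ[k] Module.End k W) (h : D →ₐ[k] Module.End k X)

@[simp]
theorem tensorAct_tmul (a : A) (b : B) : tensorAct f g (a ⊗ₜ b) = TensorProduct.map (f a) (g b) :=
  rfl

theorem tensorAct_tmul_tmul (a : A) (b : B) (v : V) (w : W) :
    tensorAct f g (a ⊗ₜ b) (v ⊗ₜ w) = f a v ⊗ₜ g b w := rfl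

/-- Induction principle for triple tensor products. -/
theorem tensor_induction₃ {V W X : Type*} [AddCommGroup V] [Module k V] [AddCommGroup W]
    [Module k W] [AddCommGroup X] [Module k X] {P : V ⊗[k] (W ⊗[k] X) → Prop}
    (zero : P 0) (tmul : ∀ v w x, P (v ⊗ₜ (w ⊗ₜ x))) (add : ∀ a b, P a → P b → P (a + b))
    (t : V ⊗[k] (W ⊗[k] X)) : P t := by
  induction t using TensorProduct.induction_on with
  | zero => exact zero
  | tmul v y =>
    induction y using TensorProduct.induction_on with
    | zero => simpa using zero
    | tmul w x => exact tmul v w x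
    | add a b ha hb => rw [TensorProduct.tmul_add]; exact add _ _ ha hb
  | add a b ha hb => exact add _ _ ha hb

/-- Induction principle for triple tensor products. -/
theorem tensor_induction₃' {V W X : Type*} [AddCommGroup V] [Module k V] [AddCommGroup W]
    [Module k W] [AddCommGroup X] [Module k X] {P : (V ⊗[k] W) ⊗[k] X → Prop}
    (zero : P 0) (tmul : ∀ v w x, P ((v ⊗ₜ w) ⊗ₜ x)) (add : ∀ a b, P a → P b → P (a + b))
    (t : (V ⊗[k] W) ⊗[k] X) : P t := by
  induction t using TensorProduct.induction_on with
  | zero => exact zero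
  | tmul y x =>
    induction y using TensorProduct.induction_on with
    | zero => simpa using zero
    | tmul v w => exact tmul v w x
    | add a b ha hb => rw [TensorProduct.add_tmul]; exact add _ _ ha hb
  | add a b ha hb => exact add _ _ ha hb

theorem tensorAct_comp_second {B' : Type*} [Ring B'] [Algebra k B'] (φ : B' →ₐ[k] B)
    (x : A ⊗[k] B') :
    tensorAct f (g.comp φ) x = tensorAct f g (applySecond φ x) := by
  induction x using TensorProduct.induction_on with
  | zero => simp
  | tmul a b => simp
  | add x y hx hy => rw [map_add, map_add, map_add, hx, hy]

theorem assoc_tensorAct (x : (A ⊗[k] B) ⊗[k] D) (w : (V ⊗[k] W) ⊗[k] X) :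
    TensorProduct.assoc k V W X (tensorAct (tensorAct f g) h x w) =
      tensorAct f (tensorAct g h) (Algebra.TensorProduct.assoc k k k A B D x)
        (TensorProduct.assoc k V W X w) := by
  induction x using tensor_induction₃' with
  | zero => simp
  | tmul a b d =>
    induction w using tensor_induction₃' with
    | zero => simp
    | tmul v w x => simp
    | add x y hx hy => simp only [map_add, hx, hy]
  | add x y hx hy => simp only [map_add, hx, hy, LinearMap.add_apply]

theorem assoc_tensorAct_comul (Δ : A →ₐ[k] A ⊗[k] A) (f : A →ₐ[k] Module.End k V)
    (g : A →ₐ[k] Module.End k W) (x : A ⊗[k] B) (h : B →ₐ[k] Module.End k X)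
    (w : (V ⊗[k] W) ⊗[k] X) :
    TensorProduct.assoc k V W X (tensorAct ((tensorAct f g).comp Δ) h x w) =
      tensorAct f (tensorAct g h) (comulFirst Δ B x) (TensorProduct.assoc k V W X w) := by
  rw [comulFirst, AlgHom.comp_apply]
  refine Eq.trans ?_ (assoc_tensorAct f g h _ w)
  congr 2
  induction x using TensorProduct.induction_on with
  | zero => simp
  | tmul a b => simp
  | add x y hx hy => simp only [map_add, hx, hy]

theorem comm_tensorAct (x : A ⊗[k] B) (w : V ⊗[k] W) :
    TensorProduct.comm k V W (tensorAct f g x w) =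
      tensorAct g f (Algebra.TensorProduct.comm k A B x) (TensorProduct.comm k V W w) := by
  induction x using TensorProduct.induction_on with
  | zero => simp
  | tmul a b =>
    induction w using TensorProduct.induction_on with
    | zero => simp
    | tmul v w => simp
    | add x y hx hy => simp only [map_add, hx, hy]
  | add x y hx hy => simp only [map_add, hx, hy, LinearMap.add_apply]

theorem lTensor_act (b : B) :
    LinearMap.lTensor V (g b) = tensorAct f g (oneTensor k A B b) := by
  simp [oneTensor, LinearMap.lTensor]
  rfl

theorem rTensor_act (a : A) :
    LinearMap.rTensor W (f a) = tensorAct f g (a ⊗ₜ 1) := by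
  simp [LinearMap.rTensor]
  rfl

/-- A map that intertwines up to an algebra homomorphism does so after tensoring. -/
theorem map_tensorAct {A' B' V' W' : Type*} [Ring A'] [Algebra k A'] [Ring B'] [Algebra k B']
    [AddCommGroup V'] [Module k V'] [AddCommGroup W'] [Module k W'] (f' : A' →ₐ[k] Module.End k V')
    (g' : B' →ₐ[k] Module.End k W') (φ : A →ₐ[k] A') (ψ : B →ₐ[k] B') (S : V →ₗ[k] V')
    (T : W →ₗ[k] W') (hS : ∀ a v, S (f a v) = f' (φ a) (S v))
    (hT : ∀ b w, T (g b w) = g' (ψ b) (T w)) (x : A ⊗[k] B) (w : V ⊗[k] W) :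
    TensorProduct.map S T (tensorAct f g x w) =
      tensorAct f' g' (Algebra.TensorProduct.map φ ψ x) (TensorProduct.map S T w) := by
  induction x using TensorProduct.induction_on with
  | zero => simp
  | tmul a b =>
    induction w using TensorProduct.induction_on with
    | zero => simp
    | tmul v w => simp [hS, hT]
    | add x y hx hy => simp only [map_add, hx, hy]
  | add x y hx hy => simp only [map_add, hx, hy, LinearMap.add_apply]

theorem act_act (x y : A) (v : V) : f x (f y v) = f (x * y) v := by
  rw [map_mul, Module.End.mul_apply]

end
end Actions

/-- The category of finite-dimensional modules over `A`: a module is a finite-dimensional vector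
space with an action of `A`. -/
structure RepFin (k A : Type u) [Field k] [Ring A] [Algebra k A] where
  /-- The underlying vector space. -/
  carrier : Type u
  [addCommGroup : AddCommGroup carrier]
  [module : Module k carrier]
  [finite : Module.Finite k carrier]
  /-- The action. -/
  act : A →ₐ[k] Module.End k carrier

namespace RepFin

attribute [instance] addCommGroup module finite

variable {k A : Type u} [Field k] [Ring A] [Algebra k A]

instance : CoeSort (RepFin k A) (Type u) := ⟨carrier⟩

/-- Morphisms: linear maps commuting with the action. -/
@[ext]
structure Hom (V W : RepFin k A) where
  /-- The underlying linear map. -/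
  lin : V →ₗ[k] W
  map_act : ∀ (a : A) (v : V), lin (V.act a v) = W.act a (lin v)

instance : Category (RepFin k A) where
  Hom V W := Hom V W
  id V := ⟨LinearMap.id, fun _ _ => rfl⟩
  comp f g := ⟨g.lin ∘ₗ f.lin, fun a v => by
    rw [LinearMap.comp_apply, f.map_act, g.map_act, LinearMap.comp_apply]⟩

@[ext]
theorem hom_ext {V W : RepFin k A} {f g : V ⟶ W} (h : ∀ v, Hom.lin f v = Hom.lin g v) : f = g :=
  Hom.ext (LinearMap.ext h)

@[simp]
theorem id_lin (V : RepFin k A) (v : V) : Hom.lin (𝟙 V) v = v := rfl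

@[simp]
theorem comp_lin {U V W : RepFin k A} (f : U ⟶ V) (g : V ⟶ W) (u : U) :
    Hom.lin (f ≫ g) u = Hom.lin g (Hom.lin f u) := rfl

variable (V W : RepFin k A)

instance : Zero (V ⟶ W) := ⟨⟨0, fun a v => by simp⟩⟩

instance : Add (V ⟶ W) := ⟨fun f g => ⟨f.lin + g.lin, fun a v => by simp [f.map_act, g.map_act]⟩⟩

instance : Neg (V ⟶ W) := ⟨fun f => ⟨-f.lin, fun a v => by simp [f.map_act]⟩⟩

instance : Sub (V ⟶ W) := ⟨fun f g => ⟨f.lin - g.lin, fun a v => by simp [f.map_act, g.map_act]⟩⟩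

instance : SMul ℕ (V ⟶ W) := ⟨fun n f => ⟨n • f.lin, fun a v => by simp [f.map_act]⟩⟩

instance : SMul ℤ (V ⟶ W) := ⟨fun n f => ⟨n • f.lin, fun a v => by simp [f.map_act]⟩⟩

instance : SMul k (V ⟶ W) := ⟨fun n f => ⟨n • f.lin, fun a v => by simp [f.map_act]⟩⟩

theorem lin_injective : Function.Injective (fun f : V ⟶ W => Hom.lin f) := fun _ _ h => Hom.ext h

instance : AddCommGroup (V ⟶ W) :=
  (lin_injective V W).addCommGroup _ rfl (fun _ _ => rfl) (fun _ => rfl) (fun _ _ => rfl)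
    (fun _ _ => rfl) (fun _ _ => rfl)

/-- Taking the underlying linear map is additive. -/
def linAddHom : (V ⟶ W) →+ (V →ₗ[k] W) where
  toFun f := Hom.lin f
  map_zero' := rfl
  map_add' _ _ := rfl

instance : Module k (V ⟶ W) :=
  (lin_injective V W).module k (linAddHom V W) (fun _ _ => rfl)

instance : Preadditive (RepFin k A) where
  add_comp U V W f g h := hom_ext fun u => map_add (Hom.lin h) _ _
  comp_add U V W f g h := rfl

instance : Linear k (RepFin k A) where
  smul_comp U V W c f g := hom_ext fun u => map_smul (Hom.lin g) _ _
  comp_smul U V W f c g := rfl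

end RepFin

section Action

variable {k : Type u} [Field k] {A V : Type*} [Ring A] [Algebra k A] [AddCommGroup V] [Module k V]

/-- The action of a unit, as a linear equivalence. -/
def actEquiv (f : A →ₐ[k] Module.End k V) (x : Aˣ) : V ≃ₗ[k] V :=
  LinearEquiv.ofLinearMap (f x.val) (f x.inv)
    (by rw [← Module.End.mul_eq_comp, ← map_mul, x.val_inv, map_one]; rfl)
    (by rw [← Module.End.mul_eq_comp, ← map_mul, x.inv_val, map_one]; rfl)

end Action

namespace RepFin

open QuasiHopfAlgebra

variable {k A : Type u} [Field k] [Ring A] [Algebra k A]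

/-- An invertible linear map that commutes with the action is an isomorphism. -/
def mkIso {V W : RepFin k A} (e : V ≃ₗ[k] W) (h : ∀ a v, e (V.act a v) = W.act a (e v)) :
    V ≅ W where
  hom := ⟨e.toLinearMap, h⟩
  inv := ⟨e.symm.toLinearMap, fun a w => by
    apply e.injective
    rw [LinearEquiv.coe_coe, e.apply_symm_apply, h, e.apply_symm_apply]⟩
  hom_inv_id := hom_ext fun v => e.symm_apply_apply v
  inv_hom_id := hom_ext fun v => e.apply_symm_apply v

variable [QuasiHopfAlgebra k A]

/-- The tensor product of modules, on which `A` acts through the coproduct. -/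
abbrev tensorObj (V W : RepFin k A) : RepFin k A where
  carrier := V ⊗[k] W
  act := (tensorAct V.act W.act).comp comul

/-- The tensor unit, on which `A` acts through the counit. -/
abbrev tensorUnit : RepFin k A where
  carrier := k
  act := (Algebra.lmul k k).comp counit

/-- The tensor product of morphisms. -/
def tensorMap {V V' W W' : RepFin k A} (f : V ⟶ V') (g : W ⟶ W') :
    tensorObj V W ⟶ tensorObj V' W' where
  lin := TensorProduct.map (Hom.lin f) (Hom.lin g)
  map_act a w := by
    have := map_tensorAct V.act W.act V'.act W'.act (AlgHom.id k A) (AlgHom.id k A) (Hom.lin f)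
      (Hom.lin g) (Hom.map_act f) (Hom.map_act g) (comul a) w
    rw [Algebra.TensorProduct.map_id] at this
    exact this

/-- The action of `A ⊗ A ⊗ A` on a triple tensor product. -/
abbrev act₃ (U V W : RepFin k A) : A ⊗[k] (A ⊗[k] A) →ₐ[k] Module.End k (U ⊗[k] (V ⊗[k] W)) :=
  tensorAct U.act (tensorAct V.act W.act)

theorem tensorObj_right_act (U V W : RepFin k A) (a : A) :
    (tensorObj U (tensorObj V W)).act a = act₃ U V W (applySecond comul (comul a)) :=
  tensorAct_comp_second U.act (tensorAct V.act W.act) comul (comul a)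

theorem tensorObj_left_act (U V W : RepFin k A) (a : A) (w : (U ⊗[k] V) ⊗[k] W) :
    TensorProduct.assoc k U V W ((tensorObj (tensorObj U V) W).act a w) =
      act₃ U V W (comulFirst comul A (comul a)) (TensorProduct.assoc k U V W w) :=
  assoc_tensorAct_comul comul U.act V.act (comul a) W.act w

theorem coassoc' (a : A) : (assoc (k := k) (A := A)).inv * comulFirst comul A (comul a) =
    applySecond comul (comul a) * (assoc (k := k) (A := A)).inv := by
  have h := coassoc (k := k) a
  calc
    _ = assoc.inv * (comulFirst comul A (comul a) * assoc.val) * (assoc (k := k) (A := A)).inv := by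
      rw [mul_assoc, mul_assoc, assoc.val_inv, mul_one]
    _ = _ := by
      rw [h, ← mul_assoc, assoc.inv_val, one_mul]

/-- The associator `(U ⊗ V) ⊗ W ≅ U ⊗ (V ⊗ W)`, which acts by `Φ⁻¹`. -/
def associator (U V W : RepFin k A) :
    tensorObj (tensorObj U V) W ≅ tensorObj U (tensorObj V W) :=
  mkIso ((TensorProduct.assoc k U V W).trans (actEquiv (act₃ U V W) assoc⁻¹)) (fun a w => by
    refine Eq.trans (congrArg (act₃ U V W assoc.inv) (tensorObj_left_act U V W a w)) ?_
    rw [act_act, coassoc', ← act_act, ← tensorObj_right_act]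
    rfl)

/-- The left unitor. -/
def leftUnitor (V : RepFin k A) : tensorObj tensorUnit V ≅ V :=
  mkIso (TensorProduct.lid k V) (fun a w => by
    have key : ∀ (x : A ⊗[k] A) (w : k ⊗[k] V),
        TensorProduct.lid k V (tensorAct ((Algebra.lmul k k).comp counit) V.act x w) =
          V.act (TensorProduct.lid k A (TensorProduct.map counit.toLinearMap .id x))
            (TensorProduct.lid k V w) := by
      intro x w
      induction x using TensorProduct.induction_on with
      | zero => simp
      | tmul a b =>
        induction w using TensorProduct.induction_on with
        | zero => simp
        | tmul v w => simp [mul_smul, smul_comm v]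
        | add x y hx hy => simp only [map_add, hx, hy]
      | add x y hx hy => simp only [map_add, hx, hy, LinearMap.add_apply]
    refine (key (comul a) w).trans ?_
    rw [counit_comul])

/-- The right unitor. -/
def rightUnitor (V : RepFin k A) : tensorObj V tensorUnit ≅ V :=
  mkIso (TensorProduct.rid k V) (fun a w => by
    have key : ∀ (x : A ⊗[k] A) (w : V ⊗[k] k),
        TensorProduct.rid k V (tensorAct V.act ((Algebra.lmul k k).comp counit) x w) =
          V.act (TensorProduct.rid k A (TensorProduct.map .id counit.toLinearMap x))
            (TensorProduct.rid k V w) := by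
      intro x w
      induction x using TensorProduct.induction_on with
      | zero => simp
      | tmul a b =>
        induction w using TensorProduct.induction_on with
        | zero => simp
        | tmul v w => simp [mul_smul, smul_comm w]
        | add x y hx hy => simp only [map_add, hx, hy]
      | add x y hx hy => simp only [map_add, hx, hy, LinearMap.add_apply]
    refine (key (comul a) w).trans ?_
    rw [comul_counit])

end RepFin

namespace RepFin

open QuasiHopfAlgebra

variable {k A : Type u} [Field k] [Ring A] [Algebra k A] [QuasiHopfAlgebra k A]

theorem associator_lin (U V W : RepFin k A) (w : (U ⊗[k] V) ⊗[k] W) :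
    Hom.lin (associator U V W).hom w = act₃ U V W assoc.inv (TensorProduct.assoc k U V W w) := rfl

theorem tensorMap_lin {V V' W W' : RepFin k A} (f : V ⟶ V') (g : W ⟶ W') (w : V ⊗[k] W) :
    Hom.lin (tensorMap f g) w = TensorProduct.map (Hom.lin f) (Hom.lin g) w := rfl

theorem associator_natural {U U' V V' W W' : RepFin k A} (f : U ⟶ U') (g : V ⟶ V')
    (h : W ⟶ W') : tensorMap (tensorMap f g) h ≫ (associator U' V' W').hom =
      (associator U V W).hom ≫ tensorMap f (tensorMap g h) := by
  apply hom_ext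
  intro (w : (U ⊗[k] V) ⊗[k] W)
  have h₁ : ∀ t : (U ⊗[k] V) ⊗[k] W, TensorProduct.assoc k U' V' W'
      (TensorProduct.map (TensorProduct.map (Hom.lin f) (Hom.lin g)) (Hom.lin h) t) =
      TensorProduct.map (Hom.lin f) (TensorProduct.map (Hom.lin g) (Hom.lin h))
        (TensorProduct.assoc k U V W t) := by
    intro t
    induction t using tensor_induction₃' with
    | zero => simp
    | tmul u v w => simp
    | add a b ha hb => simp only [map_add, ha, hb]
  have h₂ : ∀ (x : A ⊗[k] (A ⊗[k] A)) (t : U ⊗[k] (V ⊗[k] W)),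
      TensorProduct.map (Hom.lin f) (TensorProduct.map (Hom.lin g) (Hom.lin h))
        (act₃ U V W x t) = act₃ U' V' W' x
          (TensorProduct.map (Hom.lin f) (TensorProduct.map (Hom.lin g) (Hom.lin h)) t) := by
    intro x t
    induction x using tensor_induction₃ with
    | zero => simp
    | tmul a b c =>
      induction t using tensor_induction₃ with
      | zero => simp
      | tmul u v w => simp [act₃, Hom.map_act]
      | add a b ha hb => simp only [map_add, ha, hb]
    | add a b ha hb => simp only [map_add, ha, hb, LinearMap.add_apply]
  exact (congrArg (act₃ U' V' W' assoc.inv) (h₁ w)).trans (h₂ assoc.inv _).symm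

theorem pentagon_inv :
    leg₂₃₄ k A assoc.inv * applySecond (comulFirst comul A) assoc.inv *
      leg₁₂₃ k A assoc.inv =
    applySecond (applySecond comul) assoc.inv * comulFirst comul (A ⊗[k] A) assoc.inv := by
  have h : Units.map (comulFirst comul (A ⊗[k] A)).toMonoidHom (assoc (k := k) (A := A)) *
      Units.map (applySecond (applySecond comul)).toMonoidHom assoc =
      Units.map (leg₁₂₃ k A).toMonoidHom assoc *
      Units.map (applySecond (comulFirst comul A)).toMonoidHom assoc *
      Units.map (leg₂₃₄ k A).toMonoidHom assoc := Units.ext pentagon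
  have h' := congrArg (fun u => (u⁻¹).val) h
  simp only [mul_inv_rev, Units.val_mul, ← map_inv] at h'
  rw [← mul_assoc] at h'
  exact h'.symm

/-- The action of the fourfold tensor product. -/
abbrev act₄ (U V W X : RepFin k A) :
    A ⊗[k] (A ⊗[k] (A ⊗[k] A)) →ₐ[k] Module.End k (U ⊗[k] (V ⊗[k] (W ⊗[k] X))) :=
  tensorAct U.act (act₃ V W X)

theorem tensorAct_act₃ (W X Y Z : RepFin k A) (x : A ⊗[k] (A ⊗[k] A))
    (t : (W ⊗[k] (X ⊗[k] Y)) ⊗[k] Z) :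
    TensorProduct.map LinearMap.id (TensorProduct.assoc k X Y Z).toLinearMap
      (TensorProduct.assoc k W (X ⊗[k] Y) Z
        (TensorProduct.map (act₃ W X Y x) LinearMap.id t)) =
    act₄ W X Y Z (leg₁₂₃ k A x)
      (TensorProduct.map LinearMap.id (TensorProduct.assoc k X Y Z).toLinearMap
        (TensorProduct.assoc k W (X ⊗[k] Y) Z t)) := by
  induction x using tensor_induction₃ with
  | zero => simp
  | tmul a b c =>
    induction t using tensor_induction₃' with
    | zero => simp
    | tmul w y z =>
      induction y using TensorProduct.induction_on with
      | zero => simp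
      | tmul x y => simp [act₃, act₄]
      | add a b ha hb => simp only [map_add, ha, hb, TensorProduct.tmul_add, TensorProduct.add_tmul]
    | add a b ha hb => simp only [map_add, ha, hb]
  | add a b ha hb =>
    simp only [map_add, LinearMap.add_apply, TensorProduct.map_add_left, ha, hb]

theorem act₃_tensorObj_middle (W X Y Z : RepFin k A) (x : A ⊗[k] (A ⊗[k] A))
    (t : W ⊗[k] ((X ⊗[k] Y) ⊗[k] Z)) :
    TensorProduct.map LinearMap.id (TensorProduct.assoc k X Y Z).toLinearMap
      (act₃ W (tensorObj X Y) Z x t) =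
    act₄ W X Y Z (applySecond (comulFirst comul A) x)
      (TensorProduct.map LinearMap.id (TensorProduct.assoc k X Y Z).toLinearMap t) :=
  map_tensorAct W.act (tensorAct (tensorObj X Y).act Z.act) W.act (act₃ X Y Z) (AlgHom.id k A)
    (comulFirst comul A) LinearMap.id (TensorProduct.assoc k X Y Z).toLinearMap
    (fun _ _ => rfl) (fun b w => assoc_tensorAct_comul comul X.act Y.act b Z.act w) x t

theorem act₃_tensorObj_left (W X Y Z : RepFin k A) (x : A ⊗[k] (A ⊗[k] A))
    (t : (W ⊗[k] X) ⊗[k] (Y ⊗[k] Z)) :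
    TensorProduct.assoc k W X (Y ⊗[k] Z) (act₃ (tensorObj W X) Y Z x t) =
      act₄ W X Y Z (comulFirst comul (A ⊗[k] A) x)
        (TensorProduct.assoc k W X (Y ⊗[k] Z) t) :=
  assoc_tensorAct_comul comul W.act X.act x (tensorAct Y.act Z.act) t

theorem act₃_tensorObj_right (W X Y Z : RepFin k A) (x : A ⊗[k] (A ⊗[k] A)) :
    act₃ W X (tensorObj Y Z) x = act₄ W X Y Z (applySecond (applySecond comul) x) := by
  have h : tensorAct X.act (tensorObj Y Z).act = (act₃ X Y Z).comp (applySecond comul) :=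
    AlgHom.ext fun y => tensorAct_comp_second X.act (tensorAct Y.act Z.act) comul y
  exact (congrArg (fun g => tensorAct W.act g x) h).trans
    (tensorAct_comp_second W.act (act₃ X Y Z) (applySecond comul) x)

theorem pentagon_assoc (W X Y Z : RepFin k A) (t : ((W ⊗[k] X) ⊗[k] Y) ⊗[k] Z) :
    TensorProduct.map LinearMap.id (TensorProduct.assoc k X Y Z).toLinearMap
      (TensorProduct.assoc k W (X ⊗[k] Y) Z
        (TensorProduct.map (TensorProduct.assoc k W X Y).toLinearMap LinearMap.id t)) =
    TensorProduct.assoc k W X (Y ⊗[k] Z) (TensorProduct.assoc k (W ⊗[k] X) Y Z t) := by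
  induction t using tensor_induction₃' with
  | zero => simp
  | tmul w y z =>
    induction w using TensorProduct.induction_on with
    | zero => simp
    | tmul w x => simp
    | add a b ha hb => simp only [map_add, ha, hb, TensorProduct.add_tmul]
  | add a b ha hb => simp only [map_add, ha, hb]

theorem pentagon_lin (W X Y Z : RepFin k A) (t : ((W ⊗[k] X) ⊗[k] Y) ⊗[k] Z) :
    TensorProduct.map LinearMap.id (act₃ X Y Z assoc.inv)
      (TensorProduct.map LinearMap.id (TensorProduct.assoc k X Y Z).toLinearMap
        (act₃ W (tensorObj X Y) Z assoc.inv (TensorProduct.assoc k W (X ⊗[k] Y) Z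
          (TensorProduct.map (act₃ W X Y assoc.inv) LinearMap.id
            (TensorProduct.map (TensorProduct.assoc k W X Y).toLinearMap LinearMap.id t))))) =
    act₃ W X (tensorObj Y Z) assoc.inv (TensorProduct.assoc k W X (Y ⊗[k] Z)
      (act₃ (tensorObj W X) Y Z assoc.inv (TensorProduct.assoc k (W ⊗[k] X) Y Z t))) := by
  have h₄ : TensorProduct.map LinearMap.id (act₃ X Y Z assoc.inv) =
      act₄ W X Y Z (leg₂₃₄ k A assoc.inv) := lTensor_act W.act (act₃ X Y Z) assoc.inv
  rw [act₃_tensorObj_middle, tensorAct_act₃, h₄, act₃_tensorObj_left,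
    act₃_tensorObj_right, pentagon_assoc]
  have h := congrArg (act₄ W X Y Z) (pentagon_inv (k := k) (A := A))
  rw [map_mul, map_mul, map_mul] at h
  exact LinearMap.congr_fun h _

theorem pentagon_hom (W X Y Z : RepFin k A) :
    tensorMap (associator W X Y).hom (𝟙 Z) ≫ (associator W (tensorObj X Y) Z).hom ≫
      tensorMap (𝟙 W) (associator X Y Z).hom =
    (associator (tensorObj W X) Y Z).hom ≫ (associator W X (tensorObj Y Z)).hom := by
  apply hom_ext
  intro (t : ((W ⊗[k] X) ⊗[k] Y) ⊗[k] Z)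
  refine Eq.trans ?_ (pentagon_lin W X Y Z t)
  rw [← LinearMap.comp_apply (TensorProduct.map LinearMap.id (act₃ X Y Z assoc.inv)),
    ← TensorProduct.map_comp, ← LinearMap.comp_apply (TensorProduct.map (act₃ W X Y assoc.inv) _),
    ← TensorProduct.map_comp]
  rfl

theorem triangle_lin (X Y : RepFin k A) (x : A ⊗[k] (A ⊗[k] A)) (t : (X ⊗[k] k) ⊗[k] Y) :
    TensorProduct.map LinearMap.id (TensorProduct.lid k Y).toLinearMap
      (act₃ X tensorUnit Y x (TensorProduct.assoc k X k Y t)) =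
    tensorAct X.act Y.act (TensorProduct.map .id
        (TensorProduct.lid k A ∘ₗ TensorProduct.map counit.toLinearMap .id) x)
      (TensorProduct.map (TensorProduct.rid k X).toLinearMap LinearMap.id t) := by
  induction x using tensor_induction₃ with
  | zero => simp
  | tmul a b c =>
    induction t using tensor_induction₃' with
    | zero => simp
    | tmul x r y =>
      simp [mul_smul, TensorProduct.smul_tmul', TensorProduct.tmul_smul, smul_comm r]
    | add a b ha hb => simp only [map_add, ha, hb]
  | add a b ha hb => simp only [map_add, ha, hb, LinearMap.add_apply]

theorem triangle_hom (X Y : RepFin k A) :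
    (associator X tensorUnit Y).hom ≫ tensorMap (𝟙 X) (leftUnitor Y).hom =
      tensorMap (rightUnitor X).hom (𝟙 Y) := by
  apply hom_ext
  intro (t : (X ⊗[k] k) ⊗[k] Y)
  refine (triangle_lin X Y assoc.inv t).trans ?_
  have h : TensorProduct.map .id
      (TensorProduct.lid k A ∘ₗ TensorProduct.map counit.toLinearMap .id)
        (assoc (k := k) (A := A)).inv = (1 : A ⊗[k] A) := by
    let F : A ⊗[k] (A ⊗[k] A) →ₐ[k] A ⊗[k] A := applySecond
      ((Algebra.TensorProduct.lid k A).toAlgHom.comp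
        (Algebra.TensorProduct.map counit (AlgHom.id k A)))
    have h₁ : F assoc.val = 1 := assoc_counit
    have h₂ : F assoc.inv = 1 := by
      have h₃ : F assoc.val * F assoc.inv = 1 := by rw [← map_mul, assoc.val_inv, map_one]
      rwa [h₁, one_mul] at h₃
    exact h₂
  rw [h, map_one]
  rfl

theorem leftUnitor_natural {X Y : RepFin k A} (f : X ⟶ Y) :
    tensorMap (𝟙 tensorUnit) f ≫ (leftUnitor Y).hom = (leftUnitor X).hom ≫ f := by
  apply hom_ext
  intro (t : k ⊗[k] X)
  change TensorProduct.lid k Y (TensorProduct.map .id (Hom.lin f) t) =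
    Hom.lin f (TensorProduct.lid k X t)
  induction t using TensorProduct.induction_on with
  | zero => simp
  | tmul r x => simp
  | add a b ha hb => simp only [map_add, ha, hb]

theorem rightUnitor_natural {X Y : RepFin k A} (f : X ⟶ Y) :
    tensorMap f (𝟙 tensorUnit) ≫ (rightUnitor Y).hom = (rightUnitor X).hom ≫ f := by
  apply hom_ext
  intro (t : X ⊗[k] k)
  change TensorProduct.rid k Y (TensorProduct.map (Hom.lin f) .id t) =
    Hom.lin f (TensorProduct.rid k X t)
  induction t using TensorProduct.induction_on with
  | zero => simp
  | tmul r x => simp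
  | add a b ha hb => simp only [map_add, ha, hb]

theorem tensorMap_def {V V' W W' : RepFin k A} (f : V ⟶ V') (g : W ⟶ W') :
    tensorMap f g = tensorMap f (𝟙 W) ≫ tensorMap (𝟙 V') g := by
  apply hom_ext
  intro (t : V ⊗[k] W)
  change TensorProduct.map (Hom.lin f) (Hom.lin g) t = TensorProduct.map .id (Hom.lin g)
    (TensorProduct.map (Hom.lin f) .id t)
  rw [← LinearMap.comp_apply, ← TensorProduct.map_comp]
  rfl

instance : MonoidalCategory (RepFin k A) where
  tensorObj := tensorObj
  tensorUnit := tensorUnit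
  tensorHom f g := tensorMap f g
  whiskerLeft V _ _ f := tensorMap (𝟙 V) f
  whiskerRight f W := tensorMap f (𝟙 W)
  associator := associator
  leftUnitor := leftUnitor
  rightUnitor := rightUnitor
  tensorHom_def f g := tensorMap_def f g
  id_tensorHom_id _ _ := hom_ext fun t => LinearMap.congr_fun TensorProduct.map_id t
  tensorHom_comp_tensorHom _ _ _ _ := hom_ext fun t =>
    LinearMap.congr_fun (TensorProduct.map_comp _ _ _ _).symm t
  whiskerLeft_id _ _ := hom_ext fun t => LinearMap.congr_fun TensorProduct.map_id t
  id_whiskerRight _ _ := hom_ext fun t => LinearMap.congr_fun TensorProduct.map_id t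
  associator_naturality f g h := associator_natural f g h
  leftUnitor_naturality f := leftUnitor_natural f
  rightUnitor_naturality f := rightUnitor_natural f
  pentagon W X Y Z := pentagon_hom W X Y Z
  triangle X Y := triangle_hom X Y

end RepFin

namespace RepFin

variable {k A : Type u} [Field k] [Ring A] [Algebra k A]

section

variable [QuasiHopfAlgebra k A]

instance : MonoidalPreadditive (RepFin k A) where
  whiskerLeft_zero := hom_ext fun t => LinearMap.congr_fun (TensorProduct.map_zero_right _) t
  zero_whiskerRight := hom_ext fun t => LinearMap.congr_fun (TensorProduct.map_zero_left _) t
  whiskerLeft_add f g := hom_ext fun t =>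
    LinearMap.congr_fun (TensorProduct.map_add_right _ (Hom.lin f) (Hom.lin g)) t
  add_whiskerRight f g := hom_ext fun t =>
    LinearMap.congr_fun (TensorProduct.map_add_left (Hom.lin f) (Hom.lin g) _) t

instance : MonoidalLinear k (RepFin k A) where
  whiskerLeft_smul _ _ _ r f := hom_ext fun t =>
    LinearMap.congr_fun (TensorProduct.map_smul_right r _ (Hom.lin f)) t
  smul_whiskerRight r _ _ f _ := hom_ext fun t =>
    LinearMap.congr_fun (TensorProduct.map_smul_left r (Hom.lin f) _) t

end

section Braiding

variable (X Y Z : RepFin k A)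

theorem act₃_cycle (x : A ⊗[k] (A ⊗[k] A)) (t : X ⊗[k] (Y ⊗[k] Z)) :
    TensorProduct.assoc k Y Z X (TensorProduct.comm k X (Y ⊗[k] Z) (act₃ X Y Z x t)) =
      act₃ Y Z X (perm₂₃₁ k A x)
        (TensorProduct.assoc k Y Z X (TensorProduct.comm k X (Y ⊗[k] Z) t)) := by
  induction x using tensor_induction₃ with
  | zero => simp
  | tmul a b c =>
    induction t using tensor_induction₃ with
    | zero => simp
    | tmul u v w => simp
    | add a b ha hb => simp only [map_add, ha, hb]
  | add a b ha hb => simp only [map_add, ha, hb, LinearMap.add_apply]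

theorem act₃_cycle_inv (x : A ⊗[k] (A ⊗[k] A)) (t : X ⊗[k] (Y ⊗[k] Z)) :
    TensorProduct.comm k (X ⊗[k] Y) Z ((TensorProduct.assoc k X Y Z).symm (act₃ X Y Z x t)) =
      act₃ Z X Y (perm₃₁₂ k A x)
        (TensorProduct.comm k (X ⊗[k] Y) Z ((TensorProduct.assoc k X Y Z).symm t)) := by
  induction x using tensor_induction₃ with
  | zero => simp
  | tmul a b c =>
    induction t using tensor_induction₃ with
    | zero => simp
    | tmul u v w => simp
    | add a b ha hb => simp only [map_add, ha, hb]
  | add a b ha hb => simp only [map_add, ha, hb, LinearMap.add_apply]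

theorem act₃_leftComm (x : A ⊗[k] (A ⊗[k] A)) (t : X ⊗[k] (Y ⊗[k] Z)) :
    TensorProduct.leftComm k X Y Z (act₃ X Y Z x t) =
      act₃ Y X Z (perm₂₁₃ k A x) (TensorProduct.leftComm k X Y Z t) := by
  induction x using tensor_induction₃ with
  | zero => simp
  | tmul a b c =>
    induction t using tensor_induction₃ with
    | zero => simp
    | tmul u v w => simp
    | add a b ha hb => simp only [map_add, ha, hb]
  | add a b ha hb => simp only [map_add, ha, hb, LinearMap.add_apply]

theorem act₃_rightComm (x : A ⊗[k] (A ⊗[k] A)) (t : X ⊗[k] (Y ⊗[k] Z)) :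
    TensorProduct.map LinearMap.id (TensorProduct.comm k Y Z).toLinearMap (act₃ X Y Z x t) =
      act₃ X Z Y (perm₁₃₂ k A x)
        (TensorProduct.map LinearMap.id (TensorProduct.comm k Y Z).toLinearMap t) := by
  induction x using tensor_induction₃ with
  | zero => simp
  | tmul a b c =>
    induction t using tensor_induction₃ with
    | zero => simp
    | tmul u v w => simp
    | add a b ha hb => simp only [map_add, ha, hb]
  | add a b ha hb => simp only [map_add, ha, hb, LinearMap.add_apply]

theorem act₃_leg₁₂ (x : A ⊗[k] A) (t : (X ⊗[k] Y) ⊗[k] Z) :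
    TensorProduct.assoc k X Y Z
      (TensorProduct.map (tensorAct X.act Y.act x) LinearMap.id t) =
      act₃ X Y Z (leg₁₂ k A x) (TensorProduct.assoc k X Y Z t) := by
  induction x using TensorProduct.induction_on with
  | zero => simp
  | tmul a b =>
    induction t using tensor_induction₃' with
    | zero => simp
    | tmul u v w => simp
    | add a b ha hb => simp only [map_add, ha, hb]
  | add a b ha hb =>
    simp only [map_add, ha, hb, LinearMap.add_apply, TensorProduct.map_add_left]

theorem act₃_leg₂₃ (x : A ⊗[k] A) :
    TensorProduct.map LinearMap.id (tensorAct Y.act Z.act x) = act₃ X Y Z (leg₂₃ k A x) :=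
  lTensor_act X.act (tensorAct Y.act Z.act) x

theorem assoc_map_comm (t : (X ⊗[k] Y) ⊗[k] Z) :
    TensorProduct.assoc k Y X Z
      (TensorProduct.map (TensorProduct.comm k X Y).toLinearMap LinearMap.id t) =
      TensorProduct.leftComm k X Y Z (TensorProduct.assoc k X Y Z t) := by
  induction t using tensor_induction₃' with
  | zero => simp
  | tmul u v w => simp
  | add a b ha hb => simp only [map_add, ha, hb]

theorem rightComm_leftComm (t : X ⊗[k] (Y ⊗[k] Z)) :
    TensorProduct.map LinearMap.id (TensorProduct.comm k X Z).toLinearMap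
      (TensorProduct.leftComm k X Y Z t) =
      TensorProduct.assoc k Y Z X (TensorProduct.comm k X (Y ⊗[k] Z) t) := by
  induction t using tensor_induction₃ with
  | zero => simp
  | tmul u v w => simp
  | add a b ha hb => simp only [map_add, ha, hb]

theorem leftComm_rightComm (t : X ⊗[k] (Y ⊗[k] Z)) :
    TensorProduct.leftComm k X Z Y
      (TensorProduct.map LinearMap.id (TensorProduct.comm k Y Z).toLinearMap t) =
      TensorProduct.comm k (X ⊗[k] Y) Z ((TensorProduct.assoc k X Y Z).symm t) := by
  induction t using tensor_induction₃ with
  | zero => simp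
  | tmul u v w => simp
  | add a b ha hb => simp only [map_add, ha, hb]

theorem perm₁₃₂_perm₂₁₃ (x : A ⊗[k] (A ⊗[k] A)) :
    perm₁₃₂ k A (perm₂₁₃ k A x) = perm₂₃₁ k A x := by
  induction x using tensor_induction₃ with
  | zero => simp
  | tmul u v w => simp
  | add a b ha hb => simp only [map_add, ha, hb]

theorem perm₂₁₃_perm₁₃₂ (x : A ⊗[k] (A ⊗[k] A)) :
    perm₂₁₃ k A (perm₁₃₂ k A x) = perm₃₁₂ k A x := by
  induction x using tensor_induction₃ with
  | zero => simp
  | tmul u v w => simp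
  | add a b ha hb => simp only [map_add, ha, hb]

theorem perm₂₁₃_perm₂₁₃ (x : A ⊗[k] (A ⊗[k] A)) :
    perm₂₁₃ k A (perm₂₁₃ k A x) = x := by
  induction x using tensor_induction₃ with
  | zero => simp
  | tmul u v w => simp
  | add a b ha hb => simp only [map_add, ha, hb]

theorem perm₁₃₂_perm₁₃₂ (x : A ⊗[k] (A ⊗[k] A)) :
    perm₁₃₂ k A (perm₁₃₂ k A x) = x := by
  induction x using tensor_induction₃ with
  | zero => simp
  | tmul u v w => simp
  | add a b ha hb => simp only [map_add, ha, hb]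

theorem perm₂₃₁_leg₁₃ (x : A ⊗[k] A) :
    perm₂₃₁ k A (leg₁₃ k A x) = perm₁₃₂ k A (leg₂₃ k A x) := by
  induction x using TensorProduct.induction_on with
  | zero => simp
  | tmul u v => simp
  | add a b ha hb => simp only [map_add, ha, hb]

theorem perm₃₁₂_leg₁₃ (x : A ⊗[k] A) :
    perm₃₁₂ k A (leg₁₃ k A x) = perm₂₁₃ k A (leg₁₂ k A x) := by
  induction x using TensorProduct.induction_on with
  | zero => simp
  | tmul u v => simp
  | add a b ha hb => simp only [map_add, ha, hb]

open QuasiHopfAlgebra QuasiTriangularQuasiHopfAlgebra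

variable [QuasiTriangularQuasiHopfAlgebra k A]

/-- The braiding `τ ∘ R`. -/
def braiding (V W : RepFin k A) : tensorObj V W ≅ tensorObj W V :=
  mkIso ((actEquiv (tensorAct V.act W.act) rMatrix).trans (TensorProduct.comm k V W))
    (fun a t => by
      have h := LinearMap.congr_fun
        (congrArg (tensorAct V.act W.act) (rMatrix_comul (k := k) a)) t
      rw [map_mul, map_mul] at h
      refine (congrArg (TensorProduct.comm k V W) h).trans ?_
      refine (comm_tensorAct V.act W.act (tensorFlip k A (comul a)) _).trans ?_
      have h' : Algebra.TensorProduct.comm k A A (tensorFlip k A (comul a)) = comul a :=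
        (tensorFlip k A).symm_apply_apply _
      rw [h']
      rfl)

theorem braiding_lin (V W : RepFin k A) (t : V ⊗[k] W) :
    Hom.lin (braiding V W).hom t =
      TensorProduct.comm k V W (tensorAct V.act W.act rMatrix.val t) := rfl

theorem hexagon_forward_elt :
    assoc.inv * perm₂₃₁ k A (applySecond comul rMatrix.val) * perm₂₃₁ k A assoc.inv =
      perm₁₃₂ k A (leg₂₃ k A rMatrix.val * assoc.inv *
        perm₂₁₃ k A (leg₁₂ k A rMatrix.val)) := by
  have h : perm₂₃₁ k A (perm₃₁₂ k A assoc.val) = assoc.val :=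
    (perm₂₃₁ k A).apply_symm_apply _
  rw [hexagon_right]
  simp only [map_mul, h, perm₂₃₁_leg₁₃, perm₁₃₂_perm₂₁₃]
  rw [← perm₁₃₂_perm₂₁₃ (perm₂₁₃ k A assoc.inv), perm₂₁₃_perm₂₁₃]
  calc
    _ = (assoc.inv * assoc.val) * perm₁₃₂ k A (leg₂₃ k A rMatrix.val) * perm₁₃₂ k A assoc.inv *
        perm₂₃₁ k A (leg₁₂ k A rMatrix.val) * perm₂₃₁ k A (assoc.val * assoc.inv) := by
      simp only [map_mul, mul_assoc]
    _ = _ := by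
      rw [assoc.inv_val, assoc.val_inv, map_one, one_mul, mul_one]

theorem hexagon_reverse_elt :
    assoc.val * perm₃₁₂ k A (comulFirst comul A rMatrix.val) * perm₃₁₂ k A assoc.val =
      perm₂₁₃ k A (leg₁₂ k A rMatrix.val * assoc.val *
        perm₁₃₂ k A (leg₂₃ k A rMatrix.val)) := by
  have h : perm₃₁₂ k A (perm₂₃₁ k A assoc.inv) = assoc.inv :=
    (perm₂₃₁ k A).symm_apply_apply _
  rw [hexagon_left]
  simp only [map_mul, h, perm₃₁₂_leg₁₃, perm₂₁₃_perm₁₃₂]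
  rw [← perm₂₁₃_perm₁₃₂ (perm₁₃₂ k A assoc.val), perm₁₃₂_perm₁₃₂]
  calc
    _ = (assoc.val * assoc.inv) * perm₂₁₃ k A (leg₁₂ k A rMatrix.val) * perm₂₁₃ k A assoc.val *
        perm₃₁₂ k A (leg₂₃ k A rMatrix.val) * perm₃₁₂ k A (assoc.inv * assoc.val) := by
      simp only [map_mul, mul_assoc]
    _ = _ := by
      rw [assoc.inv_val, assoc.val_inv, map_one, one_mul, mul_one]

end Braiding

end RepFin

namespace RepFin

open QuasiHopfAlgebra QuasiTriangularQuasiHopfAlgebra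

variable {k A : Type u} [Field k] [Ring A] [Algebra k A]

section

variable [QuasiTriangularQuasiHopfAlgebra k A] (X Y Z : RepFin k A)

theorem hexagon_forward_lin (t : (X ⊗[k] Y) ⊗[k] Z) :
    act₃ Y Z X assoc.inv (TensorProduct.assoc k Y Z X (TensorProduct.comm k X (Y ⊗[k] Z)
      (tensorAct X.act (tensorObj Y Z).act rMatrix.val
        (act₃ X Y Z assoc.inv (TensorProduct.assoc k X Y Z t))))) =
    TensorProduct.map LinearMap.id (TensorProduct.comm k X Z).toLinearMap
      (TensorProduct.map LinearMap.id (tensorAct X.act Z.act rMatrix.val)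
        (act₃ Y X Z assoc.inv (TensorProduct.assoc k Y X Z
          (TensorProduct.map (TensorProduct.comm k X Y).toLinearMap LinearMap.id
            (TensorProduct.map (tensorAct X.act Y.act rMatrix.val) LinearMap.id t))))) := by
  have h₁ : tensorAct X.act (tensorObj Y Z).act rMatrix.val =
      act₃ X Y Z (applySecond comul rMatrix.val) :=
    tensorAct_comp_second X.act (tensorAct Y.act Z.act) comul _
  rw [h₁, act₃_leg₂₃, act₃_cycle, act₃_cycle, assoc_map_comm, act₃_leg₁₂, act₃_leftComm,
    act₃_rightComm, act₃_rightComm, act₃_rightComm, rightComm_leftComm]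
  have h := congrArg (act₃ Y Z X) (hexagon_forward_elt (k := k) (A := A))
  simp only [map_mul, mul_assoc] at h
  exact LinearMap.congr_fun h _

theorem hexagon_reverse_lin (t : X ⊗[k] (Y ⊗[k] Z)) :
    act₃ Z X Y assoc.val (TensorProduct.comm k (X ⊗[k] Y) Z
      (tensorAct (tensorObj X Y).act Z.act rMatrix.val
        ((TensorProduct.assoc k X Y Z).symm (act₃ X Y Z assoc.val t)))) =
    TensorProduct.assoc k Z X Y
      (TensorProduct.map (TensorProduct.comm k X Z).toLinearMap LinearMap.id
        (TensorProduct.map (tensorAct X.act Z.act rMatrix.val) LinearMap.id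
          ((TensorProduct.assoc k X Z Y).symm (act₃ X Z Y assoc.val
            (TensorProduct.map LinearMap.id (TensorProduct.comm k Y Z).toLinearMap
              (TensorProduct.map LinearMap.id (tensorAct Y.act Z.act rMatrix.val) t)))))) := by
  have h₁ : ∀ s : X ⊗[k] (Y ⊗[k] Z), tensorAct (tensorObj X Y).act Z.act rMatrix.val
      ((TensorProduct.assoc k X Y Z).symm s) = (TensorProduct.assoc k X Y Z).symm
        (act₃ X Y Z (comulFirst comul A rMatrix.val) s) := by
    intro s
    apply (TensorProduct.assoc k X Y Z).injective
    rw [LinearEquiv.apply_symm_apply]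
    refine (assoc_tensorAct_comul comul X.act Y.act rMatrix.val Z.act _).trans ?_
    rw [LinearEquiv.apply_symm_apply]
  rw [h₁, act₃_leg₂₃, act₃_cycle_inv, act₃_cycle_inv, assoc_map_comm, act₃_leg₁₂,
    LinearEquiv.apply_symm_apply, act₃_rightComm, act₃_leftComm, act₃_leftComm, act₃_leftComm,
    leftComm_rightComm]
  have h := congrArg (act₃ Z X Y) (hexagon_reverse_elt (k := k) (A := A))
  simp only [map_mul, mul_assoc] at h
  exact LinearMap.congr_fun h _

theorem hexagon_forward_hom :
    (α_ X Y Z).hom ≫ (braiding X (Y ⊗ Z)).hom ≫ (α_ Y Z X).hom =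
      (braiding X Y).hom ▷ Z ≫ (α_ Y X Z).hom ≫ Y ◁ (braiding X Z).hom := by
  apply hom_ext
  intro (t : (X ⊗[k] Y) ⊗[k] Z)
  refine (hexagon_forward_lin X Y Z t).trans ?_
  rw [TensorProduct.map_map, TensorProduct.map_map]
  rfl

theorem hexagon_reverse_hom :
    (α_ X Y Z).inv ≫ (braiding (X ⊗ Y) Z).hom ≫ (α_ Z X Y).inv =
      X ◁ (braiding Y Z).hom ≫ (α_ X Z Y).inv ≫ (braiding X Z).hom ▷ Y := by
  apply hom_ext
  intro (t : X ⊗[k] (Y ⊗[k] Z))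
  apply (TensorProduct.assoc k Z X Y).injective
  refine Eq.trans ((TensorProduct.assoc k Z X Y).apply_symm_apply _) ?_
  refine (hexagon_reverse_lin X Y Z t).trans ?_
  rw [TensorProduct.map_map, TensorProduct.map_map]
  rfl

theorem braiding_natural {X X' Y Y' : RepFin k A} (f : X ⟶ X') (g : Y ⟶ Y') :
    tensorMap f g ≫ (braiding X' Y').hom = (braiding X Y).hom ≫ tensorMap g f := by
  apply hom_ext
  intro (t : X ⊗[k] Y)
  have h := map_tensorAct X.act Y.act X'.act Y'.act (AlgHom.id k A) (AlgHom.id k A) (Hom.lin f)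
      (Hom.lin g) (Hom.map_act f) (Hom.map_act g) rMatrix.val t
  rw [Algebra.TensorProduct.map_id] at h
  refine (congrArg (TensorProduct.comm k X' Y') h.symm).trans ?_
  exact (TensorProduct.map_comm (Hom.lin g) (Hom.lin f) _).symm

instance : BraidedCategory (RepFin k A) where
  braiding := braiding
  braiding_naturality_right X _ _ f := braiding_natural (𝟙 X) f
  braiding_naturality_left f Z := braiding_natural f (𝟙 Z)
  hexagon_forward := hexagon_forward_hom
  hexagon_reverse := hexagon_reverse_hom

end

end RepFin

section Contraction

variable {k : Type u} [Field k] {V : Type v} [AddCommGroup V] [Module k V]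

/-- The map `v ⊗ φ ↦ (w ↦ φ(w) v)`. -/
def rankOne (k : Type u) [Field k] (V : Type v) [AddCommGroup V] [Module k V] :
    V ⊗[k] Module.Dual k V →ₗ[k] Module.End k V :=
  dualTensorHom k V V ∘ₗ (TensorProduct.comm k V (Module.Dual k V)).toLinearMap

@[simp]
theorem rankOne_tmul (v w : V) (φ : Module.Dual k V) : rankOne k V (v ⊗ₜ φ) w = φ w • v := rfl

theorem rankOne_map (S T : Module.End k V) (w : V ⊗[k] Module.Dual k V) :
    rankOne k V (TensorProduct.map S (Module.Dual.transpose T) w) = S ∘ₗ rankOne k V w ∘ₗ T := by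
  induction w using TensorProduct.induction_on with
  | zero => simp
  | tmul v φ =>
    ext u
    simp [Module.Dual.transpose_apply]
  | add a b ha hb => rw [map_add, map_add, ha, hb, map_add, LinearMap.add_comp, LinearMap.comp_add]

variable [Module.Finite k V]

theorem rankOne_injective : Function.Injective (rankOne k V) :=
  (dualTensorHomEquiv k V V).injective.comp (TensorProduct.comm k V (Module.Dual k V)).injective

theorem rankOne_coevaluation (r : k) : rankOne k V (coevaluation k V r) = r • LinearMap.id := by
  have h : rankOne k V (coevaluation k V 1) = LinearMap.id := by
    rw [coevaluation_apply_one]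
    ext w
    simp only [map_sum, LinearMap.sum_apply, rankOne_tmul, LinearMap.id_apply, Module.Basis.coord_apply]
    exact (Module.Basis.ofVectorSpace k V).sum_repr w
  rw [← h, ← map_smul, ← map_smul, smul_eq_mul, mul_one]

end Contraction

namespace RepFin

open QuasiHopfAlgebra

variable {k A : Type u} [Field k] [Ring A] [Algebra k A] [QuasiHopfAlgebra k A]

/-- The dual module, on which `A` acts by `(a.φ)(v) = φ(S(a).v)`. -/
abbrev dual (V : RepFin k A) : RepFin k A where
  carrier := Module.Dual k V
  act := AlgHom.ofLinearMap (Module.Dual.transpose ∘ₗ V.act.toLinearMap ∘ₗ antipode)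
    (by
      ext φ v
      simp [antipode_one, Module.Dual.transpose_apply])
    (fun a b => by
      ext φ v
      simp [antipode_mul, Module.Dual.transpose_apply])

theorem dual_act (V : RepFin k A) (a : A) :
    (dual V).act a = Module.Dual.transpose (V.act (antipode (k := k) a)) := rfl

@[simp]
theorem dual_act_apply (V : RepFin k A) (a : A) (φ : Module.Dual k V) (v : V) :
    (dual V).act a φ v = φ (V.act (antipode (k := k) a) v) := rfl

/-- The linear map `φ ⊗ v ↦ φ(α.v)`. -/
def evalLin (V : RepFin k A) : Module.Dual k V ⊗[k] V →ₗ[k] k :=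
  contractLeft k V ∘ₗ TensorProduct.map LinearMap.id (V.act (alpha k))

/-- The linear map `1 ↦ ∑ β.vᵢ ⊗ vᵢ*`. -/
noncomputable def coevalLin (V : RepFin k A) : k →ₗ[k] V ⊗[k] Module.Dual k V :=
  TensorProduct.map (V.act (beta k)) LinearMap.id ∘ₗ coevaluation k V

@[simp]
theorem evalLin_tmul (V : RepFin k A) (φ : Module.Dual k V) (v : V) :
    evalLin V (φ ⊗ₜ v) = φ (V.act (alpha k) v) := rfl

theorem rankOne_coevalLin (V : RepFin k A) (r : k) :
    rankOne k V (coevalLin V r) = r • V.act (beta k) := by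
  have h := rankOne_map (V.act (beta k)) LinearMap.id (coevaluation k V r)
  rw [rankOne_coevaluation] at h
  refine h.trans ?_
  ext v
  simp

theorem evalLin_act (V : RepFin k A) (x : A ⊗[k] A) (t : Module.Dual k V ⊗[k] V)
    (c : k) (hx : antipodeLeft antipode (alpha k) x = c • alpha k (A := A)) :
    evalLin V (tensorAct (dual V).act V.act x t) = c * evalLin V t := by
  induction t using TensorProduct.induction_on with
  | zero => simp
  | tmul φ v =>
    have h : ∀ x : A ⊗[k] A, evalLin V (tensorAct (dual V).act V.act x (φ ⊗ₜ v)) =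
        φ (V.act (antipodeLeft antipode (alpha k) x) v) := by
      intro x
      induction x using TensorProduct.induction_on with
      | zero => simp
      | tmul a b => simp [Module.Dual.transpose_apply]
      | add a b ha hb => simp only [map_add, LinearMap.add_apply, ha, hb]
    rw [h, hx]
    simp
  | add a b ha hb => simp only [map_add, ha, hb, mul_add]

theorem rankOne_act (V : RepFin k A) (x : A ⊗[k] A) (r : k) :
    rankOne k V (tensorAct V.act (dual V).act x (coevalLin V r)) =
      r • V.act (antipodeRight antipode (beta k) x) := by
  induction x using TensorProduct.induction_on with
  | zero => simp
  | tmul a b =>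
    rw [tensorAct_tmul, dual_act, rankOne_map, rankOne_coevalLin]
    ext v
    simp
  | add a b ha hb => simp only [map_add, LinearMap.add_apply, ha, hb, smul_add]

/-- The evaluation. -/
def eval (V : RepFin k A) : dual V ⊗ V ⟶ 𝟙_ (RepFin k A) where
  lin := evalLin V
  map_act a t := evalLin_act V (comul a) t (counit a) (antipode_alpha a)

/-- The coevaluation. -/
noncomputable def coeval (V : RepFin k A) : 𝟙_ (RepFin k A) ⟶ V ⊗ dual V where
  lin := coevalLin V
  map_act a r := rankOne_injective (by
    refine (rankOne_coevalLin V (counit a * r)).trans ?_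
    refine Eq.trans ?_ (rankOne_act V (comul a) r).symm
    rw [antipode_beta, map_smul, smul_smul, mul_comm])

theorem zigzagRight_lin (V : RepFin k A) (x : A ⊗[k] (A ⊗[k] A)) (r : k) (v : V) :
    TensorProduct.rid k V (TensorProduct.map LinearMap.id (evalLin V)
      (act₃ V (dual V) V x (TensorProduct.assoc k V (Module.Dual k V) V (coevalLin V r ⊗ₜ v)))) =
      r • V.act (zigzagRight antipode (alpha k) (beta k) x) v := by
  induction x using tensor_induction₃ with
  | zero => simp
  | tmul a b c =>
    have h : ∀ w : V ⊗[k] Module.Dual k V,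
        TensorProduct.rid k V (TensorProduct.map LinearMap.id (evalLin V)
          (act₃ V (dual V) V (a ⊗ₜ (b ⊗ₜ c))
            (TensorProduct.assoc k V (Module.Dual k V) V (w ⊗ₜ v)))) =
        V.act a (rankOne k V w (V.act (antipode (k := k) b * alpha k * c) v)) := by
      intro w
      induction w using TensorProduct.induction_on with
      | zero => simp
      | tmul u φ => simp [Module.Dual.transpose_apply]
      | add a b ha hb =>
        simp only [map_add, TensorProduct.add_tmul, LinearMap.add_apply, ha, hb]
    rw [h, rankOne_coevalLin]
    simp
  | add a b ha hb => simp only [map_add, LinearMap.add_apply, ha, hb, smul_add]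

theorem zigzagLeft_lin (V : RepFin k A) (x : A ⊗[k] (A ⊗[k] A)) (r : k) (φ : Module.Dual k V) :
    TensorProduct.lid k (Module.Dual k V) (TensorProduct.map (evalLin V) LinearMap.id
      ((TensorProduct.assoc k (Module.Dual k V) V (Module.Dual k V)).symm
        (act₃ (dual V) V (dual V) x (φ ⊗ₜ coevalLin V r)))) =
      r • (φ ∘ₗ V.act (zigzagLeft antipode (alpha k) (beta k) x)) := by
  induction x using tensor_induction₃ with
  | zero => simp
  | tmul a b c =>
    have h : ∀ w : V ⊗[k] Module.Dual k V,
        TensorProduct.lid k (Module.Dual k V) (TensorProduct.map (evalLin V) LinearMap.id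
          ((TensorProduct.assoc k (Module.Dual k V) V (Module.Dual k V)).symm
            (act₃ (dual V) V (dual V) (a ⊗ₜ (b ⊗ₜ c)) (φ ⊗ₜ w)))) =
        φ ∘ₗ V.act (antipode (k := k) a * alpha k * b) ∘ₗ rankOne k V w ∘ₗ
          V.act (antipode (k := k) c) := by
      intro w
      induction w using TensorProduct.induction_on with
      | zero => simp
      | tmul u ψ =>
        ext y
        simp [mul_comm, Module.Dual.transpose_apply]
      | add a b ha hb =>
        simp only [map_add, TensorProduct.tmul_add, ha, hb,
          LinearMap.comp_add, LinearMap.add_comp]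
    rw [h, rankOne_coevalLin]
    ext y
    simp
  | add a b ha hb =>
    simp only [map_add, LinearMap.add_apply, ha, hb, smul_add, LinearMap.comp_add]

theorem hom_ext_tensor {V W U : RepFin k A} {f g : V ⊗ W ⟶ U}
    (h : ∀ (v : V) (w : W), Hom.lin f (v ⊗ₜ[k] w) = Hom.lin g (v ⊗ₜ[k] w)) : f = g :=
  Hom.ext (TensorProduct.ext' h)

theorem coevaluation_evaluation_hom (V : RepFin k A) :
    dual V ◁ coeval V ≫ (α_ (dual V) V (dual V)).inv ≫ eval V ▷ dual V =
      (ρ_ (dual V)).hom ≫ (λ_ (dual V)).inv := by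
  rw [← cancel_mono (λ_ (dual V)).hom]
  apply hom_ext_tensor
  intro (φ : Module.Dual k V) (r : k)
  refine (zigzagLeft_lin V assoc.val r φ).trans ?_
  rw [zigzag_left, map_one, Category.assoc, Iso.inv_hom_id, Category.comp_id]
  rfl

theorem evaluation_coevaluation_hom (V : RepFin k A) :
    coeval V ▷ V ≫ (α_ V (dual V) V).hom ≫ V ◁ eval V = (λ_ V).hom ≫ (ρ_ V).inv := by
  rw [← cancel_mono (ρ_ V).hom]
  apply hom_ext_tensor
  intro (r : k) (v : V)
  refine (zigzagRight_lin V assoc.inv r v).trans ?_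
  rw [zigzag_right, map_one, Category.assoc, Iso.inv_hom_id, Category.comp_id]
  rfl

noncomputable instance : RightRigidCategory (RepFin k A) where
  rightDual V :=
    { rightDual := dual V
      exact :=
        { coevaluation' := coeval V
          evaluation' := eval V
          coevaluation_evaluation' := coevaluation_evaluation_hom V
          evaluation_coevaluation' := evaluation_coevaluation_hom V } }

theorem evaluation_lin (V : RepFin k A) (φ : Module.Dual k V) (v : V) :
    Hom.lin (ε_ V Vᘁ) (φ ⊗ₜ[k] v) = φ (V.act (alpha k) v) := rfl

/-- The dual of a morphism is its transpose. -/
theorem rightAdjointMate_lin {V W : RepFin k A} (f : V ⟶ W) (φ : Module.Dual k W) :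
    Hom.lin (fᘁ) φ = φ ∘ₗ Hom.lin f := by
  let g : Wᘁ ⟶ Vᘁ := ⟨Module.Dual.transpose (Hom.lin f), fun a (φ : Module.Dual k W) =>
    LinearMap.ext fun v => congrArg (fun w : W => φ w) (Hom.map_act f (antipode (k := k) a) v).symm⟩
  have h : fᘁ = g := by
    apply UnivCoend.dual_hom_ext
    rw [rightAdjointMate_comp_evaluation]
    apply hom_ext_tensor
    intro (φ : Module.Dual k W) (v : V)
    exact congrArg (fun w : W => φ w) (Hom.map_act f (alpha k) v).symm
  rw [h]
  rfl

end RepFin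

namespace RepFin

open QuasiHopfAlgebra

variable {k A : Type u} [Field k] [Ring A] [Algebra k A] [Module.Finite k A]

variable (k A) in
/-- The regular module. -/
abbrev regular : RepFin k A where
  carrier := A
  act := Algebra.lmul k A

/-- The morphism `A ⟶ V`, `a ↦ a.v`. -/
def orbit (V : RepFin k A) (v : V) : regular k A ⟶ V where
  lin := V.act.toLinearMap.flip v
  map_act a b := by
    change V.act (a * b) v = V.act a (V.act b v)
    rw [map_mul, Module.End.mul_apply]

variable [QuasiHopfAlgebra k A]

variable (k A) in
/-- The algebra homomorphism from `A ⊗ A` to the endomorphisms of `A*` given by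
`((a ⊗ b).f)(x) = f(S(a) x b)`. -/
noncomputable def coadjointAct : A ⊗[k] A →ₐ[k] Module.End k (Module.Dual k A) :=
  Algebra.TensorProduct.lift (dual (regular k A)).act
    (AlgHom.ofLinearMap (Module.Dual.transpose ∘ₗ (LinearMap.mul k A).flip)
      (by
        ext f x
        simp [Module.Dual.transpose_apply])
      (fun a b => by
        ext f x
        simp [Module.Dual.transpose_apply, mul_assoc]))
    (fun a b => by
      ext f x
      simp [Module.Dual.transpose_apply, mul_assoc])

@[simp]
theorem coadjointAct_tmul (a b : A) (f : Module.Dual k A) (x : A) :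
    coadjointAct k A (a ⊗ₜ b) f x = f (antipode (k := k) a * x * b) := rfl

variable (k A) in
/-- The coadjoint module `A*`, with `(a.f)(x) = ∑ f(S(a') x a'')`. -/
noncomputable abbrev coadjoint : RepFin k A where
  carrier := Module.Dual k A
  act := (coadjointAct k A).comp comul

/-- The linear map `φ ⊗ v ↦ (a ↦ φ(a.v))`. -/
def matrixCoeff (V : RepFin k A) : Module.Dual k V ⊗[k] V →ₗ[k] Module.Dual k A :=
  TensorProduct.lift (LinearMap.mk₂ k (fun φ v => φ ∘ₗ V.act.toLinearMap.flip v)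
    (fun _ _ _ => LinearMap.add_comp _ _ _) (fun _ _ _ => LinearMap.smul_comp _ _ _)
    (fun φ v w => by rw [map_add, LinearMap.comp_add])
    (fun c φ v => by rw [map_smul, LinearMap.comp_smul]))

@[simp]
theorem matrixCoeff_tmul (V : RepFin k A) (φ : Module.Dual k V) (v : V) (a : A) :
    matrixCoeff V (φ ⊗ₜ v) a = φ (V.act a v) := rfl

theorem matrixCoeff_act (V : RepFin k A) (x : A ⊗[k] A) (t : Module.Dual k V ⊗[k] V) :
    matrixCoeff V (tensorAct (dual V).act V.act x t) = coadjointAct k A x (matrixCoeff V t) := by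
  induction x using TensorProduct.induction_on with
  | zero => simp
  | tmul a b =>
    induction t using TensorProduct.induction_on with
    | zero => simp
    | tmul φ v =>
      ext y
      simp [Module.Dual.transpose_apply]
    | add a b ha hb => simp only [map_add, ha, hb]
  | add a b ha hb => simp only [map_add, LinearMap.add_apply, ha, hb]

/-- The dinatural family of the coend. -/
noncomputable def coadjointIota (V : RepFin k A) : Vᘁ ⊗ V ⟶ coadjoint k A where
  lin := matrixCoeff V
  map_act a t := matrixCoeff_act V (comul a) t

theorem coadjointIota_dinatural : Dinatural (coadjointIota (k := k) (A := A)) := ⟨by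
  intro V W f
  apply hom_ext_tensor
  intro (φ : Module.Dual k W) (v : V)
  refine (congrArg (fun ψ => matrixCoeff V (ψ ⊗ₜ v)) (rightAdjointMate_lin f φ)).trans ?_
  exact LinearMap.ext fun a => congrArg (fun w : W => φ w) (Hom.map_act f a v)⟩

/-- The morphism out of the coadjoint module that is determined by a dinatural family. -/
noncomputable def coadjointDesc (B : RepFin k A) (φ : ∀ V : RepFin k A, Vᘁ ⊗ V ⟶ B)
    (h : Dinatural φ) : coadjoint k A ⟶ B where
  lin := Hom.lin (φ (regular k A)) ∘ₗ (TensorProduct.mk k (Module.Dual k A) A).flip 1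
  map_act a f := by
    have key : ∀ x : A ⊗[k] A, Hom.lin (φ (regular k A)) (coadjointAct k A x f ⊗ₜ[k] (1 : A)) =
        Hom.lin (φ (regular k A))
          (tensorAct (dual (regular k A)).act (regular k A).act x (f ⊗ₜ[k] (1 : A))) := by
      intro x
      induction x using TensorProduct.induction_on with
      | zero => simp
      | tmul a b =>
        have h₁ := congrArg (fun g => Hom.lin g
          (((dual (regular k A)).act a f : Module.Dual k A) ⊗ₜ[k] (1 : A)))
          (h.condition (orbit (regular k A) b))
        have h₂ : Hom.lin ((orbit (regular k A) b)ᘁ) ((dual (regular k A)).act a f) =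
            coadjointAct k A (a ⊗ₜ b) f := by
          refine (rightAdjointMate_lin _ _).trans ?_
          exact LinearMap.ext fun x => congrArg (fun y : A => (f : Module.Dual k A) y)
            (mul_assoc (antipode (k := k) a) x b).symm
        refine Eq.trans ?_ (h₁.trans ?_)
        · exact congrArg (fun g => Hom.lin (φ (regular k A)) (g ⊗ₜ[k] (1 : A))) h₂.symm
        · exact congrArg (fun y => Hom.lin (φ (regular k A))
            (((dual (regular k A)).act a f : Module.Dual k A) ⊗ₜ[k] y))
            ((one_mul b).trans (mul_one b).symm)
      | add a b ha hb =>
        simp only [map_add, LinearMap.add_apply, TensorProduct.add_tmul, ha, hb]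
    exact (key (comul a)).trans (Hom.map_act (φ (regular k A)) a (f ⊗ₜ[k] (1 : A)))

variable (k A) in
/-- The coend of `RepFin k A`: the coadjoint module with the family `φ ⊗ v ↦ (a ↦ φ(a.v))`. -/
noncomputable def coadjointCoend : UnivCoend (RepFin k A) :=
  UnivCoend.ofUniversal (coadjoint k A) coadjointIota coadjointIota_dinatural coadjointDesc
    (by
      intro B φ h V
      apply hom_ext_tensor
      intro (ψ : Module.Dual k V) (v : V)
      have h₁ := congrArg (fun g => Hom.lin g (ψ ⊗ₜ[k] (1 : A))) (h.condition (orbit V v))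
      refine Eq.trans ?_ (h₁.trans ?_)
      · exact congrArg (fun f => Hom.lin (φ (regular k A)) (f ⊗ₜ[k] (1 : A)))
          (rightAdjointMate_lin (orbit V v) ψ).symm
      · exact congrArg (fun w => Hom.lin (φ V) (ψ ⊗ₜ[k] w))
          (LinearMap.congr_fun (map_one V.act) v))
    (by
      intro B f g h
      apply hom_ext
      intro (ψ : Module.Dual k A)
      have h₁ := congrArg (fun q => Hom.lin q (ψ ⊗ₜ[k] (1 : A))) (h (regular k A))
      have h₂ : matrixCoeff (regular k A) (ψ ⊗ₜ[k] (1 : A)) = ψ := by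
        ext a
        exact congrArg ψ (mul_one a)
      exact (congrArg (Hom.lin f) h₂.symm).trans (h₁.trans (congrArg (Hom.lin g) h₂)))

end RepFin

namespace RepFin

open QuasiHopfAlgebra QuasiTriangularQuasiHopfAlgebra RibbonQuasiHopfAlgebra

section Center

variable {k A : Type u} [Field k] [Ring A] [Algebra k A]

/-- A central element acts by a natural endomorphism of the identity functor. -/
def ofCentral (z : A) (hz : ∀ a, z * a = a * z) : CatCenter (RepFin k A) where
  app V := ⟨V.act z, fun a v => by
    have h := congrArg V.act (hz a)
    rw [map_mul, map_mul] at h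
    exact LinearMap.congr_fun h v⟩
  naturality V W f := hom_ext fun v => (Hom.map_act f z v).symm

variable [Module.Finite k A]

variable (k A) in
/-- The isomorphism `ξ : Z(A) ⟶ End(id)`: a central element `z` acts on a module by `v ↦ z.v`. -/
def centerEquiv : Subalgebra.center k A ≃ₗ[k] CatCenter (RepFin k A) where
  toFun z := ofCentral z.1 (fun a => (Subalgebra.mem_center_iff.mp z.2 a).symm)
  map_add' z w := NatTrans.ext (funext fun V => hom_ext fun v =>
    LinearMap.congr_fun (map_add V.act z.1 w.1) v)
  map_smul' c z := NatTrans.ext (funext fun V => hom_ext fun v =>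
    LinearMap.congr_fun (map_smul V.act c z.1) v)
  invFun η := ⟨Hom.lin (η.app (regular k A)) (1 : A), by
    rw [Subalgebra.mem_center_iff]
    intro b
    have h₁ : Hom.lin (η.app (regular k A)) (b * 1 : A) =
        b * Hom.lin (η.app (regular k A)) (1 : A) := Hom.map_act (η.app (regular k A)) b (1 : A)
    have h₂ : Hom.lin (η.app (regular k A)) (1 * b : A) =
        Hom.lin (η.app (regular k A)) (1 : A) * b :=
      congrArg (fun g => Hom.lin g (1 : A)) (η.naturality (orbit (regular k A) b))
    rw [← h₁, ← h₂, one_mul, mul_one]⟩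
  left_inv z := Subtype.ext (mul_one z.1)
  right_inv η := NatTrans.ext (funext fun V => hom_ext fun v => by
    have h := congrArg (fun g => Hom.lin g (1 : A)) (η.naturality (orbit V v))
    refine h.symm.trans ?_
    exact congrArg (Hom.lin (η.app V)) (LinearMap.congr_fun (map_one V.act) v))

end Center

section Twist

variable {k A : Type u} [Field k] [Ring A] [Algebra k A]

theorem monodromy_lin [QuasiTriangularQuasiHopfAlgebra k A] (V W : RepFin k A) (t : V ⊗[k] W) :
    Hom.lin ((β_ V W).hom ≫ (β_ W V).hom) t =
      tensorAct V.act W.act (monodromy k A).val t := by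
  refine (comm_tensorAct W.act V.act _ _).trans ?_
  have h : (monodromy k A).val = tensorFlip k A (rMatrix (k := k)).val *
      (rMatrix (k := k) (A := A)).val := rfl
  rw [h, map_mul]
  refine congrArg (tensorAct V.act W.act (tensorFlip k A (rMatrix (k := k)).val)) ?_
  exact (TensorProduct.comm k V W).symm_apply_apply _

variable (k A) in
/-- `x ⊗ y ↦ ε(x) y`. -/
def counitLeft [QuasiHopfAlgebra k A] : A ⊗[k] A →ₐ[k] A :=
  (Algebra.TensorProduct.lid k A).toAlgHom.comp
    (Algebra.TensorProduct.map counit (AlgHom.id k A))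

variable [Module.Finite k A]

theorem counit_monodromy [QuasiTriangularQuasiHopfAlgebra k A] :
    counitLeft k A (monodromy k A).val = 1 := by
  have h₁ : ∀ x : A ⊗[k] A, TensorProduct.lid k A
      (tensorAct (tensorUnit (k := k) (A := A)).act (regular k A).act x ((1 : k) ⊗ₜ (1 : A))) =
      counitLeft k A x := by
    intro x
    induction x using TensorProduct.induction_on with
    | zero => simp
    | tmul a b => simp [counitLeft]
    | add a b ha hb => simp only [map_add, LinearMap.add_apply, ha, hb]
  have h₂ : (β_ (𝟙_ (RepFin k A)) (regular k A)).hom ≫ (β_ (regular k A) (𝟙_ (RepFin k A))).hom =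
      𝟙 _ := by
    rw [braiding_tensorUnit_left, braiding_tensorUnit_right, Category.assoc,
      Iso.inv_hom_id_assoc, Iso.hom_inv_id]
  have h₃ := monodromy_lin (𝟙_ (RepFin k A)) (regular k A) ((1 : k) ⊗ₜ[k] (1 : A))
  rw [h₂] at h₃
  refine (h₁ _).symm.trans ((congrArg (TensorProduct.lid k A) h₃.symm).trans ?_)
  exact one_smul k (1 : A)

variable [RibbonQuasiHopfAlgebra k A]

theorem counit_ribbon : counit (ribbon k (A := A)) = (1 : k) := by
  have h := congrArg (counitLeft k A) (ribbon_comul (k := k) (A := A))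
  have h₁ : counitLeft k A (comul (ribbon k)) = ribbon k := counit_comul (k := k) (ribbon k)
  have h₂ : counitLeft k A (ribbon k ⊗ₜ ribbon k) =
      (counit (ribbon k (A := A)) : k) • ribbon k := rfl
  rw [map_mul, counit_monodromy, one_mul, h₁, h₂] at h
  have h₃ : ((counit (ribbon k (A := A)) : k) - 1) • ribbon k (A := A) = 0 := by
    rw [sub_smul, one_smul, ← h, sub_self]
  rcases smul_eq_zero.mp h₃ with h₄ | h₄
  · exact sub_eq_zero.mp h₄
  · exact absurd h₄ (ribbon_ne_zero (k := k))

variable (k A) in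
theorem ribbon_isUnit : IsUnit (ribbon k (A := A)) := by
  have hc := ribbon_central (k := k) (A := A)
  have h₁ : ∀ x : A ⊗[k] A, antipodeLeft antipode (alpha k) (x * (ribbon k ⊗ₜ ribbon k)) =
      ribbon k * ribbon k * antipodeLeft antipode (alpha k) x := by
    intro x
    induction x using TensorProduct.induction_on with
    | zero => simp
    | tmul a b =>
      rw [Algebra.TensorProduct.tmul_mul_tmul, antipodeLeft_tmul, antipodeLeft_tmul, antipode_mul,
        antipode_ribbon, ← hc b]
      simp only [mul_assoc]
      rw [← mul_assoc (alpha k) (ribbon k) b, ← hc (alpha k), mul_assoc (ribbon k) (alpha k) b,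
        ← mul_assoc (antipode a) (ribbon k), ← hc (antipode a), mul_assoc]
    | add a b ha hb => simp only [map_add, add_mul, ha, hb, mul_add]
  have h₂ : comul (ribbon k (A := A)) = (monodromy k A).inv * (ribbon k ⊗ₜ[k] ribbon k) := by
    rw [← ribbon_comul, ← mul_assoc, (monodromy k A).inv_val, one_mul]
  have h₃ := antipode_alpha (k := k) (ribbon k (A := A))
  rw [h₂, h₁, counit_ribbon, one_smul] at h₃
  have h₄ : ∀ (s : A) (x : A ⊗[k] (A ⊗[k] A)),
      zigzagLeft (antipode (k := k)) (ribbon k * ribbon k * s) (beta k) x =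
        ribbon k * (ribbon k * zigzagLeft (antipode (k := k)) s (beta k) x) := by
    intro s x
    induction x using tensor_induction₃ with
    | zero => simp
    | tmul a b c =>
      rw [zigzagLeft_tmul, zigzagLeft_tmul]
      simp only [← mul_assoc]
      rw [← hc (antipode a), mul_assoc (ribbon k) (antipode a) (ribbon k), ← hc (antipode a)]
      simp only [mul_assoc]
    | add a b ha hb => simp only [map_add, ha, hb, mul_add]
  have h₅ := zigzag_left (k := k) (A := A)
  rw [← h₃, h₄] at h₅
  exact ⟨⟨_, _, h₅, (hc _).symm.trans h₅⟩, rfl⟩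

variable (k A) in
/-- The ribbon element is invertible. -/
noncomputable def ribbonUnit : Aˣ := (ribbon_isUnit k A).unit

theorem ribbonUnit_val : (ribbonUnit k A).val = ribbon k := rfl

theorem ribbonUnit_inv_central (a : A) : (ribbonUnit k A).inv * a = a * (ribbonUnit k A).inv :=
  ((show Commute (ribbonUnit k A).val a from ribbon_central (k := k) a).units_inv_left).eq

theorem ribbonUnit_inv_comul : comul (ribbonUnit k A).inv =
    ((ribbonUnit k A).inv ⊗ₜ[k] (ribbonUnit k A).inv) * (monodromy k A).val := by
  have h₁ : comul (ribbonUnit k A).val * comul (ribbonUnit k A).inv = (1 : A ⊗[k] A) := by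
    rw [← map_mul, (ribbonUnit k A).val_inv, map_one]
  have h₂ : ((ribbonUnit k A).inv ⊗ₜ[k] (ribbonUnit k A).inv) *
      ((ribbonUnit k A).val ⊗ₜ[k] (ribbonUnit k A).val) = (1 : A ⊗[k] A) := by
    rw [Algebra.TensorProduct.tmul_mul_tmul, (ribbonUnit k A).inv_val]
    rfl
  have h₃ : (monodromy k A).val * comul (ribbonUnit k A).val =
      (ribbonUnit k A).val ⊗ₜ[k] (ribbonUnit k A).val := ribbon_comul
  rw [← h₃, ← mul_assoc] at h₂
  calc
    _ = (((ribbonUnit k A).inv ⊗ₜ[k] (ribbonUnit k A).inv) * (monodromy k A).val *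
        comul (ribbonUnit k A).val) * comul (ribbonUnit k A).inv := by rw [h₂, one_mul]
    _ = _ := by rw [mul_assoc, h₁, mul_one]

theorem antipode_ribbonUnit_inv :
    antipode (k := k) (ribbonUnit k A).inv = (ribbonUnit k A).inv := by
  have h : (ribbonUnit k A).val * antipode (k := k) (ribbonUnit k A).inv = 1 := by
    have h₁ : antipode (k := k) ((ribbonUnit k A).inv * (ribbonUnit k A).val) = 1 := by
      rw [(ribbonUnit k A).inv_val, antipode_one]
    rw [antipode_mul] at h₁
    have h₂ : antipode (k := k) (ribbonUnit k A).val = (ribbonUnit k A).val := antipode_ribbon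
    rwa [h₂] at h₁
  calc
    _ = (ribbonUnit k A).inv * ((ribbonUnit k A).val *
        antipode (k := k) (ribbonUnit k A).inv) := by
      rw [← mul_assoc, (ribbonUnit k A).inv_val, one_mul]
    _ = _ := by rw [h, mul_one]

/-- The ribbon twist: the action of `v⁻¹`. -/
noncomputable instance : RibbonTwist (RepFin k A) where
  twist :=
    { val := ofCentral (ribbonUnit k A).inv ribbonUnit_inv_central
      inv := ofCentral (ribbonUnit k A).val (ribbon_central (k := k))
      val_inv := NatTrans.ext (funext fun V => hom_ext fun v => by
        have h := congrArg V.act (ribbonUnit k A).inv_val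
        rw [map_mul, map_one] at h
        exact LinearMap.congr_fun h v)
      inv_val := NatTrans.ext (funext fun V => hom_ext fun v => by
        have h := congrArg V.act (ribbonUnit k A).val_inv
        rw [map_mul, map_one] at h
        exact LinearMap.congr_fun h v) }
  twist_tensor V W := by
    rw [← Category.assoc]
    apply hom_ext
    intro (t : V ⊗[k] W)
    have h := congrArg (fun x => tensorAct V.act W.act x t) (ribbonUnit_inv_comul (k := k) (A := A))
    rw [map_mul] at h
    refine h.trans ?_
    exact congrArg (tensorAct V.act W.act ((ribbonUnit k A).inv ⊗ₜ[k] (ribbonUnit k A).inv))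
      (monodromy_lin V W t).symm
  twist_dual V := by
    apply hom_ext
    intro (φ : Module.Dual k V)
    refine Eq.trans ?_ (rightAdjointMate_lin _ φ).symm
    refine LinearMap.ext fun v => ?_
    exact congrArg (fun z => φ (V.act z v)) (antipode_ribbonUnit_inv (k := k) (A := A))

end Twist

end RepFin

section Formula

open QuasiHopfAlgebra QuasiTriangularQuasiHopfAlgebra

variable (k A : Type u) [Field k] [Ring A] [Algebra k A]

/-- The element
`D = (id ⊗ id ⊗ Δ)(Φ) · (1 ⊗ Φ⁻¹) · (1 ⊗ β ⊗ 1 ⊗ 1)`. -/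
def elementD [QuasiHopfAlgebra k A] : A ⊗[k] (A ⊗[k] (A ⊗[k] A)) :=
  applySecond (applySecond comul) assoc.val * leg₂₃₄ k A assoc.inv *
    (1 ⊗ₜ (beta k ⊗ₜ (1 ⊗ₜ 1)))

/-- The element
`W = (1 ⊗ α ⊗ 1 ⊗ α) · (1 ⊗ Φ⁻¹) · (1 ⊗ M ⊗ 1) · (1 ⊗ Φ) · (id ⊗ id ⊗ Δ)(Φ⁻¹)`. -/
def elementW [QuasiTriangularQuasiHopfAlgebra k A] : A ⊗[k] (A ⊗[k] (A ⊗[k] A)) :=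
  (1 ⊗ₜ (alpha k ⊗ₜ (1 ⊗ₜ alpha k))) * leg₂₃₄ k A assoc.inv *
    leg₂₃₄ k A (leg₁₂ k A (monodromy k A).val) * leg₂₃₄ k A assoc.val *
      applySecond (applySecond comul) assoc.inv

variable {k A}

/-- `x₁ ⊗ x₂ ⊗ x₃ ⊗ x₄ ↦ S(x₁) b x₂ S(x₃) a x₄`. -/
def doubleSandwich [QuasiHopfAlgebra k A] (a b : A) :
    A ⊗[k] (A ⊗[k] (A ⊗[k] A)) →ₗ[k] A :=
  LinearMap.mul' k A ∘ₗ TensorProduct.map (LinearMap.mulRight k b ∘ₗ antipode)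
    (LinearMap.mul' k A ∘ₗ TensorProduct.map LinearMap.id (antipodeLeft antipode a))

theorem doubleSandwich_tmul [QuasiHopfAlgebra k A] (a b x₁ x₂ x₃ x₄ : A) :
    doubleSandwich (k := k) a b (x₁ ⊗ₜ[k] (x₂ ⊗ₜ[k] (x₃ ⊗ₜ[k] x₄))) =
      antipode (k := k) x₁ * b * (x₂ * (antipode (k := k) x₃ * a * x₄)) := rfl

theorem antipodeLeft_add (S : A →ₗ[k] A) (a b : A) :
    antipodeLeft S (a + b) = antipodeLeft S a + antipodeLeft S b :=
  TensorProduct.ext' fun x y => by simp [mul_add, add_mul]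

theorem antipodeLeft_smul (S : A →ₗ[k] A) (c : k) (a : A) :
    antipodeLeft S (c • a) = c • antipodeLeft S a :=
  TensorProduct.ext' fun x y => by simp

variable (k A) in
/-- The map `a ⊗ b ↦ ∑ S(D₁) b D₂ S(D₃) a D₄` that is dual to the coproduct of the coend. -/
def hatComul [QuasiHopfAlgebra k A] : A ⊗[k] A →ₗ[k] A :=
  TensorProduct.lift (LinearMap.mk₂ k (fun a b => doubleSandwich (k := k) a b (elementD k A))
    (fun a a' b => by
      simp only [doubleSandwich, antipodeLeft_add, TensorProduct.map_add_right, LinearMap.comp_add,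
        LinearMap.add_apply])
    (fun c a b => by
      simp only [doubleSandwich, antipodeLeft_smul, TensorProduct.map_smul_right,
        LinearMap.comp_smul, LinearMap.smul_apply])
    (fun a b b' => by
      have h : LinearMap.mulRight k (b + b') = LinearMap.mulRight k b + LinearMap.mulRight k b' :=
        LinearMap.ext fun x => mul_add x b b'
      simp only [doubleSandwich, h, TensorProduct.map_add_left, LinearMap.add_comp,
        LinearMap.comp_add, LinearMap.add_apply])
    (fun c a b => by
      have h : LinearMap.mulRight k (c • b) = c • LinearMap.mulRight k b :=
        LinearMap.ext fun x => mul_smul_comm c x b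
      simp only [doubleSandwich, h, TensorProduct.map_smul_left, LinearMap.smul_comp,
        LinearMap.comp_smul, LinearMap.smul_apply]))

variable (k A) in
/-- The element `ω̂ = ∑ S(W₃) W₄ ⊗ S(W₁) W₂` that describes the Hopf pairing of the coend. -/
def hatPairing [QuasiTriangularQuasiHopfAlgebra k A] : A ⊗[k] A :=
  tensorFlip k A (TensorProduct.map (antipodeLeft (antipode (k := k)) 1)
    (antipodeLeft (antipode (k := k)) 1)
    ((TensorProduct.assoc k A A (A ⊗[k] A)).symm (elementW k A)))

/-- The map `z ↦ ∑ Ψ₁ β S(Ψ₂) ω̂₁ Ψ₃ · λ(Δ̂(ω̂₂ ⊗ α z))` with `Ψ = Φ⁻¹`, for a linear form `λ`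
on `A`. -/
def formulaS [QuasiTriangularQuasiHopfAlgebra k A] (l : Module.Dual k A) (z : A) : A :=
  zigzagRight (antipode (k := k))
    (TensorProduct.rid k A (TensorProduct.map LinearMap.id
      (l ∘ₗ hatComul k A ∘ₗ (TensorProduct.mk k A A).flip (alpha k * z)) (hatPairing k A)))
    (beta k) assoc.inv

variable [Module.Finite k A]

/-- The linear form `Λ̂ = Λ(1)` on `A` given by a morphism `Λ : 𝟙 ⟶ A*`. -/
noncomputable def hatIntegral [QuasiHopfAlgebra k A]
    (Λ : 𝟙_ (RepFin k A) ⟶ (RepFin.coadjointCoend k A).obj) : Module.Dual k A :=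
  RepFin.Hom.lin Λ (1 : k)

/-- The `S`-transformation transported to the centre of `A`. -/
noncomputable def centerS [QuasiTriangularQuasiHopfAlgebra k A]
    (Λ : 𝟙_ (RepFin k A) ⟶ (RepFin.coadjointCoend k A).obj) :
    Subalgebra.center k A →ₗ[k] Subalgebra.center k A :=
  (RepFin.centerEquiv k A).symm.toLinearMap ∘ₗ
    (RepFin.coadjointCoend k A).modularS k Λ ∘ₗ (RepFin.centerEquiv k A).toLinearMap

variable (k A) in
/-- The `T`-transformation transported to the centre of `A`. -/
noncomputable def centerT [RibbonQuasiHopfAlgebra k A] :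
    Subalgebra.center k A →ₗ[k] Subalgebra.center k A :=
  (RepFin.centerEquiv k A).symm.toLinearMap ∘ₗ
    modularT k ∘ₗ (RepFin.centerEquiv k A).toLinearMap

end Formula

end QuasiHopf

/-! The coend is the space `A*`, and its universal family at the regular module sends `f ⊗ 1` to
`f`. Hence the linear map underlying a morphism out of the coend can be read off from one composite,
evaluated at vectors `f ⊗ 1` (`coadjointCoend_lin_apply`); for morphisms out of two copies of the
coend the same device is used in both factors. In this way categorical statements about the
structure maps become identities in tensor powers of `A`.

Two such identities carry the proof. For the coproduct (`coadjointCoend_comul_lin`), the two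
associators contribute `(id ⊗ id ⊗ Δ)(Φ)` and `1 ⊗ Φ⁻¹`, and the coevaluation inserts `β` in the
second place; their product is `D`. For the Hopf pairing (`coadjointCoend_pairing_lin`), the
associators, the double braiding, which acts by `M`, and the two evaluations, each with its `α`,
multiply to `W`. In both cases the factors that act on dual spaces turn into antipodes, because `A`
acts on a dual through `S`, and the coproduct sits in the third leg of an associator whose third
object is itself a tensor product. A sum over dual bases is evaluated by viewing `V ⊗ V*` as
endomorphisms through `rankOne`, under which the coevaluation is the action of `β`.

Encode a morphism from the coend to the unit by the element `a` with `f ↦ f(a)`, and a morphism from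
the unit to the coend by the linear form that is its value at `1`. Then the constituents of the
S-transformation are `ψ` : `z ↦ α z` (`coadjointCoend_psi_lin`), `ρ` : `a ↦ (b ↦ Λ̂(Δ̂(b ⊗ a)))`
(`coadjointCoend_rho_lin`), `Ω` : `l ↦ ∑ ω̂₁ l(ω̂₂)` (`coadjointCoend_Omega_lin`), `ψ⁻¹` : `a ↦ ∑ Ψ₁
β S(Ψ₂) a Ψ₃` (`psiInvApp_regular_one`), and composing them gives the formula. The T-transformation
is read off at the unit of the regular module, on which the twist is multiplication by `v⁻¹`. -/

namespace QuasiHopf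

namespace RepFin

set_option maxSynthPendingDepth 6

open QuasiHopfAlgebra QuasiTriangularQuasiHopfAlgebra

/-- Induction principle for fourfold tensor products. -/
theorem tensor_induction₄ {k U V W X : Type*} [Field k] [AddCommGroup U] [Module k U]
    [AddCommGroup V] [Module k V] [AddCommGroup W] [Module k W] [AddCommGroup X] [Module k X]
    {P : U ⊗[k] (V ⊗[k] (W ⊗[k] X)) → Prop}
    (zero : P 0) (tmul : ∀ u v w x, P (u ⊗ₜ (v ⊗ₜ (w ⊗ₜ x))))
    (add : ∀ a b, P a → P b → P (a + b)) (t : U ⊗[k] (V ⊗[k] (W ⊗[k] X))) : P t := by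
  induction t using TensorProduct.induction_on with
  | zero => exact zero
  | tmul u y =>
    induction y using tensor_induction₃ with
    | zero => simpa using zero
    | tmul v w x => exact tmul u v w x
    | add a b ha hb => rw [TensorProduct.tmul_add]; exact add _ _ ha hb
  | add a b ha hb => exact add _ _ ha hb

/-! ### Reduction to the regular module -/

variable {k A : Type u} [Field k] [Ring A] [Algebra k A] [Module.Finite k A]

variable [QuasiTriangularQuasiHopfAlgebra k A]

/-- This is a linear section of the universal family at the regular module. It need not respect the
action of `A`, but it is only used to compute underlying linear maps. -/
theorem matrixCoeff_regular (f : Module.Dual k A) :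
    matrixCoeff (regular k A) (f ⊗ₜ[k] (1 : A)) = f :=
  LinearMap.ext fun a => congrArg f (mul_one a)

/-- A morphism out of the coend is determined by its composite with `ι` at the regular module. -/
theorem coadjointCoend_lin_apply {B : RepFin k A} (g : (coadjointCoend k A).obj ⟶ B)
    (f : Module.Dual k A) :
    Hom.lin g f = Hom.lin ((coadjointCoend k A).iota (regular k A) ≫ g) (f ⊗ₜ[k] (1 : A)) :=
  congrArg (Hom.lin g) (matrixCoeff_regular f).symm

/-! ### The coproduct of the coend and the element `D` -/

theorem map_id_act₃ (U V W X : RepFin k A) (x : A ⊗[k] (A ⊗[k] A)) :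
    TensorProduct.map LinearMap.id (act₃ V W X x) = act₄ U V W X (leg₂₃₄ k A x) :=
  lTensor_act U.act (act₃ V W X) x

/-- The direction of the associators decides the exponents: `(U ⊗ V) ⊗ W ⟶ U ⊗ (V ⊗ W)` acts by
`Φ⁻¹`, so the inner reassociation gives `assoc.inv` and the outer one, which goes the other way,
gives `assoc.val`. Everything else is unfolding. -/
theorem comulFamily_lin (V : RepFin k A) (φ : Module.Dual k V) (v : V) :
    Hom.lin ((coadjointCoend k A).comulFamily V) (φ ⊗ₜ[k] v) =
      TensorProduct.map (matrixCoeff V) (matrixCoeff V)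
        ((TensorProduct.assoc k (Module.Dual k V) V (Module.Dual k V ⊗[k] V)).symm
          (act₃ (dual V) V (tensorObj (dual V) V) assoc.val
            (TensorProduct.map LinearMap.id (act₃ V (dual V) V assoc.inv)
              (φ ⊗ₜ[k] TensorProduct.assoc k V (Module.Dual k V) V (coevalLin V 1 ⊗ₜ[k] v))))) :=
  rfl

/-- With `∑ β.vᵢ ⊗ vᵢ*` inserted, the first matrix coefficient at `a` is `φ(S(x₁) a x₂ β.vᵢ)` and
the second at `b` is `vᵢ*(S(x₃) b x₄.v)`; summing over `i` composes the two operators. Stating this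
for arbitrary `x` makes it linear in `x`, so that pure tensors suffice although `Φ` is a sum. -/
theorem map_matrixCoeff_act₄ (V : RepFin k A) (a b : A) (x : A ⊗[k] (A ⊗[k] (A ⊗[k] A)))
    (φ : Module.Dual k V) (v : V) :
    TensorProduct.lid k k (TensorProduct.map (Module.Dual.eval k A a) (Module.Dual.eval k A b)
      (TensorProduct.map (matrixCoeff V) (matrixCoeff V)
        ((TensorProduct.assoc k (Module.Dual k V) V (Module.Dual k V ⊗[k] V)).symm
          (act₄ (dual V) V (dual V) V x
            (φ ⊗ₜ[k] TensorProduct.assoc k V (Module.Dual k V) V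
              (coevalLin V 1 ⊗ₜ[k] v)))))) =
      φ (V.act (doubleSandwich (k := k) b a (x * (1 ⊗ₜ (beta k ⊗ₜ (1 ⊗ₜ 1))))) v) := by
  induction x using tensor_induction₄ with
  | zero =>
    rw [zero_mul]
    simp
  | tmul x₁ x₂ x₃ x₄ =>
    -- The coevaluation is not a pure tensor either, so it is replaced by an arbitrary `w` and the
    -- contraction is expressed through the endomorphism that `w` represents.
    have h : ∀ w : V ⊗[k] Module.Dual k V,
        TensorProduct.lid k k (TensorProduct.map (Module.Dual.eval k A a) (Module.Dual.eval k A b)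
          (TensorProduct.map (matrixCoeff V) (matrixCoeff V)
            ((TensorProduct.assoc k (Module.Dual k V) V (Module.Dual k V ⊗[k] V)).symm
              (act₄ (dual V) V (dual V) V (x₁ ⊗ₜ (x₂ ⊗ₜ (x₃ ⊗ₜ x₄)))
                (φ ⊗ₜ[k] TensorProduct.assoc k V (Module.Dual k V) V (w ⊗ₜ[k] v)))))) =
        φ (V.act (antipode (k := k) x₁ * a * x₂)
          (rankOne k V w (V.act (antipode (k := k) x₃ * b * x₄) v))) := by
      intro w
      induction w using TensorProduct.induction_on with
      | zero => simp
      | tmul u ψ => simp [Module.Dual.transpose_apply, mul_comm]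
      | add a b ha hb =>
        simp only [map_add, TensorProduct.add_tmul, TensorProduct.tmul_add, LinearMap.add_apply,
          ha, hb]
    -- The coevaluation represents the action of `β`, which therefore lands between `x₂` and
    -- `S(x₃)`: this is right multiplication of `x` by `1 ⊗ β ⊗ 1 ⊗ 1`.
    rw [h, rankOne_coevalLin]
    simp [doubleSandwich_tmul]
  | add x y hx hy =>
    rw [add_mul]
    simp only [map_add, LinearMap.add_apply, hx, hy]

/-- The coproduct of the coend is dual to `hatComul`, with the factors exchanged. -/
theorem coadjointCoend_comul_lin (f : Module.Dual k A) (a b : A) :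
    TensorProduct.lid k k (TensorProduct.map (Module.Dual.eval k A a) (Module.Dual.eval k A b)
      (Hom.lin (coadjointCoend k A).comul f)) = f (hatComul k A (b ⊗ₜ a)) := by
  have h₁ : (coadjointCoend k A).iota (regular k A) ≫ (coadjointCoend k A).comul =
      (coadjointCoend k A).comulFamily (regular k A) :=
    (coadjointCoend k A).iota_desc _ _ _
  have h₂ := coadjointCoend_lin_apply (coadjointCoend k A).comul f
  rw [h₁] at h₂
  rw [h₂]
  refine (congrArg (fun t => TensorProduct.lid k k (TensorProduct.map (Module.Dual.eval k A a)
    (Module.Dual.eval k A b) t)) (comulFamily_lin (regular k A) f (1 : A))).trans ?_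
  -- The two associator actions merge into that of the single element `(id ⊗ id ⊗ Δ)(Φ) · (1 ⊗
  -- Φ⁻¹)`; the preceding lemma supplies the missing `β`, which completes `D`. The exchange of `a`
  -- and `b` comes from the convention for `hatComul`, whose second argument is the one between the
  -- first two legs of `D`, and those legs belong to the first coend factor.
  rw [act₃_tensorObj_right, map_id_act₃, ← Module.End.mul_apply, ← map_mul]
  refine (map_matrixCoeff_act₄ (regular k A) a b _ f (1 : A)).trans ?_
  exact congrArg f (mul_one _)

/-! ### The isomorphism `ψ` and its inverse -/

/-- At the regular module, `z` sends the vector `1` to `z`, and the evaluation then applies `α`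
before pairing with `f`. -/
theorem coadjointCoend_psi_lin (z : Subalgebra.center k A) (f : Module.Dual k A) :
    Hom.lin ((coadjointCoend k A).psi (centerEquiv k A z)) f = f (alpha k * z) := by
  rw [coadjointCoend_lin_apply, UnivCoend.iota_psi]
  exact congrArg f (congrArg (alpha k * ·) (mul_one z.1))

/-- The natural endomorphism that corresponds to evaluation at `a`, on the regular module. -/
theorem psiInvApp_regular_one (g : (coadjointCoend k A).obj ⟶ 𝟙_ (RepFin k A)) (a : A)
    (hg : ∀ f : Module.Dual k A, Hom.lin g f = f a) :
    Hom.lin ((coadjointCoend k A).psiInvApp g (regular k A)) (1 : A) =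
      zigzagRight (antipode (k := k)) a (beta k) assoc.inv := by
  have hg' : Hom.lin g = Module.Dual.eval k A a := LinearMap.ext hg
  -- This is the computation behind the zigzag identity `zigzagRight_lin`, with one change: the
  -- evaluation, which would insert `α`, is replaced by the matrix coefficient at `a`. That is why
  -- `a` occupies the slot of `α` in `zigzagRight`.
  have key : ∀ x : A ⊗[k] (A ⊗[k] A),
      TensorProduct.rid k A (TensorProduct.map LinearMap.id (Module.Dual.eval k A a)
        (TensorProduct.map LinearMap.id (matrixCoeff (regular k A))
          (act₃ (regular k A) (dual (regular k A)) (regular k A) x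
            (TensorProduct.assoc k A (Module.Dual k A) A
              (coevalLin (regular k A) 1 ⊗ₜ[k] (1 : A)))))) =
      zigzagRight (antipode (k := k)) a (beta k) x := by
    intro x
    induction x using tensor_induction₃ with
    | zero => simp
    | tmul x₁ x₂ x₃ =>
      have h : ∀ w : A ⊗[k] Module.Dual k A,
          TensorProduct.rid k A (TensorProduct.map LinearMap.id (Module.Dual.eval k A a)
            (TensorProduct.map LinearMap.id (matrixCoeff (regular k A))
              (act₃ (regular k A) (dual (regular k A)) (regular k A) (x₁ ⊗ₜ (x₂ ⊗ₜ x₃))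
                (TensorProduct.assoc k A (Module.Dual k A) A (w ⊗ₜ[k] (1 : A)))))) =
          x₁ * rankOne k A w (antipode (k := k) x₂ * a * x₃) := by
        intro w
        induction w using TensorProduct.induction_on with
        | zero => simp
        | tmul u ψ =>
          -- The form `ψ ∘ mulLeft (S x₂)` is `x₂.ψ` in the dual of the regular module, and its
          -- coefficient with the vector `x₃` at `a` is `ψ(S(x₂) a x₃)`. The scalar comes from the
          -- right unitor.
          have h₁ : matrixCoeff (regular k A) ((ψ ∘ₗ LinearMap.mulLeft k (antipode (k := k) x₂))
              ⊗ₜ[k] (x₃ * 1 : A)) a • (x₁ * u) =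
              x₁ * (ψ (antipode (k := k) x₂ * a * x₃) • u) := by
            rw [mul_smul_comm, mul_one, mul_assoc]
            rfl
          exact h₁
        | add a b ha hb =>
          simp only [map_add, TensorProduct.add_tmul, LinearMap.add_apply, ha, hb, mul_add]
      rw [h]
      -- On the regular module the coevaluation represents left multiplication by `β`.
      have h₂ := rankOne_coevalLin (regular k A) 1
      rw [one_smul] at h₂
      refine (congrArg (fun T : Module.End k A => x₁ * T (antipode (k := k) x₂ * a * x₃))
        h₂).trans ?_
      exact (mul_assoc x₁ (beta k) _).symm
    | add x y hx hy => simp only [map_add, LinearMap.add_apply, hx, hy]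
  -- The only associator in the inverse of `ψ` goes from left to right bracketing, hence `Φ⁻¹`.
  refine Eq.trans ?_ (key assoc.inv)
  rw [← hg']
  rfl

/-! ### The transformation `ρ` -/

/-- The transformation `ρ` in terms of `hatComul`. -/
theorem coadjointCoend_rho_lin (Λ : 𝟙_ (RepFin k A) ⟶ (coadjointCoend k A).obj)
    (g : (coadjointCoend k A).obj ⟶ 𝟙_ (RepFin k A)) (a : A)
    (hg : ∀ f : Module.Dual k A, Hom.lin g f = f a) (b : A) :
    (show Module.Dual k A from Hom.lin ((coadjointCoend k A).rho k Λ g) (1 : k)) b =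
      hatIntegral Λ (hatComul k A (b ⊗ₜ a)) := by
  have hg' : Hom.lin g = Module.Dual.eval k A a := LinearMap.ext hg
  -- Contracting the first factor with `a` leaves a linear form; evaluating that form at `b` is the
  -- same as contracting both factors at once, which is the shape of `coadjointCoend_comul_lin`.
  have key : ∀ t : Module.Dual k A ⊗[k] Module.Dual k A,
      TensorProduct.lid k (Module.Dual k A)
        (TensorProduct.map (Module.Dual.eval k A a) LinearMap.id t) b =
      TensorProduct.lid k k
        (TensorProduct.map (Module.Dual.eval k A a) (Module.Dual.eval k A b) t) := by
    intro t
    induction t using TensorProduct.induction_on with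
    | zero => simp
    | tmul f f' => simp
    | add x y hx hy => simp only [map_add, LinearMap.add_apply, hx, hy]
  rw [← coadjointCoend_comul_lin]
  refine Eq.trans ?_ (key _)
  rw [← hg']
  rfl

/-! ### The Hopf pairing, the element `W` and the transformation `Ω` -/

/-- The map `x₁ ⊗ x₂ ⊗ x₃ ⊗ x₄ ↦ S(x₃) x₄ ⊗ S(x₁) x₂`. -/
def antipodePair : A ⊗[k] (A ⊗[k] (A ⊗[k] A)) →ₗ[k] A ⊗[k] A :=
  (tensorFlip k A).toLinearMap ∘ₗ
    TensorProduct.map (antipodeLeft (antipode (k := k)) 1) (antipodeLeft (antipode (k := k)) 1) ∘ₗ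
    (TensorProduct.assoc k A A (A ⊗[k] A)).symm.toLinearMap

/-- The evaluations produce `φ(S(x₁) α x₂.v)` and `ψ(S(x₃) α x₄.w)`. Each `α` stands directly to the
left of `x₂` or `x₄`, so both are absorbed into `x` by left multiplication; this is why
`antipodePair` uses `antipodeLeft` with middle element `1`, the factor `1 ⊗ α ⊗ 1 ⊗ α` being part of
`W`. The flip in `antipodePair` puts the coefficient of the second module first. -/
theorem evalLin_act₄ (V W : RepFin k A) (x : A ⊗[k] (A ⊗[k] (A ⊗[k] A)))
    (φ : Module.Dual k V) (v : V) (ψ : Module.Dual k W) (w : W) :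
    evalLin V (TensorProduct.map LinearMap.id (TensorProduct.rid k V).toLinearMap
        (TensorProduct.map LinearMap.id (TensorProduct.map LinearMap.id (evalLin W))
          (act₄ (dual V) V (dual W) W x (φ ⊗ₜ[k] (v ⊗ₜ[k] (ψ ⊗ₜ[k] w)))))) =
      TensorProduct.lid k k (TensorProduct.map (matrixCoeff W (ψ ⊗ₜ w)) (matrixCoeff V (φ ⊗ₜ v))
        (antipodePair ((1 ⊗ₜ (alpha k ⊗ₜ (1 ⊗ₜ alpha k))) * x))) := by
  induction x using tensor_induction₄ with
  | zero =>
    rw [mul_zero]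
    simp
  | tmul x₁ x₂ x₃ x₄ => simp [antipodePair, Module.Dual.transpose_apply]
  | add x y hx hy =>
    rw [mul_add]
    simp only [map_add, LinearMap.add_apply, hx, hy]

/-- The monodromy on the second and third of four factors, conjugated by associators. -/
theorem map_monodromy_lin (U V W X : RepFin k A) (t : U ⊗[k] (V ⊗[k] (W ⊗[k] X))) :
    TensorProduct.map LinearMap.id (act₃ V W X assoc.inv ∘ₗ
        (TensorProduct.assoc k V W X).toLinearMap)
      (TensorProduct.map LinearMap.id (TensorProduct.map
          (Hom.lin ((β_ V W).hom ≫ (β_ W V).hom)) LinearMap.id)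
        (TensorProduct.map LinearMap.id
          ((TensorProduct.assoc k V W X).symm.toLinearMap ∘ₗ act₃ V W X assoc.val) t)) =
      act₄ U V W X (leg₂₃₄ k A assoc.inv * leg₂₃₄ k A (leg₁₂ k A (monodromy k A).val) *
        leg₂₃₄ k A assoc.val) t := by
  have h : Hom.lin ((β_ V W).hom ≫ (β_ W V).hom) = tensorAct V.act W.act (monodromy k A).val :=
    LinearMap.ext (monodromy_lin V W)
  -- Every map involved is the identity on the first factor, so the claim reduces to the last three
  -- factors.
  rw [h, ← map_mul, ← map_mul, ← map_id_act₃, TensorProduct.map_map, TensorProduct.map_map]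
  refine congrArg (fun T => TensorProduct.map LinearMap.id T t) (LinearMap.ext fun s => ?_)
  -- In left bracketing the double braiding acts on the inner product of `V` and `W`; moved to right
  -- bracketing, it is the action of `M ⊗ 1`.
  have h₁ := act₃_leg₁₂ V W X (monodromy k A).val
    ((TensorProduct.assoc k V W X).symm (act₃ V W X assoc.val s))
  rw [LinearEquiv.apply_symm_apply] at h₁
  refine (congrArg (act₃ V W X assoc.inv) h₁).trans ?_
  rw [map_mul, map_mul]
  rfl

/-- The defining composite of the pairing, in order of application, reads the acting element from
right to left: the outer associator, whose third object is a tensor product, then `Φ`, `M` and `Φ⁻¹`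
on the last three factors. The `α`s are still inside the evaluations. -/
theorem pairingFamily_lin (V W : RepFin k A)
    (t : (Module.Dual k V ⊗[k] V) ⊗[k] (Module.Dual k W ⊗[k] W)) :
    Hom.lin (UnivCoend.pairingFamily V W) t =
      evalLin V (TensorProduct.map LinearMap.id (TensorProduct.rid k V).toLinearMap
        (TensorProduct.map LinearMap.id (TensorProduct.map LinearMap.id (evalLin W))
          (act₄ (dual V) V (dual W) W (leg₂₃₄ k A assoc.inv *
              leg₂₃₄ k A (leg₁₂ k A (monodromy k A).val) * leg₂₃₄ k A assoc.val *
              applySecond (applySecond comul) assoc.inv)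
            (TensorProduct.assoc k (Module.Dual k V) V (Module.Dual k W ⊗[k] W) t)))) := by
  refine (congrArg (fun s => evalLin V (TensorProduct.map LinearMap.id
    (TensorProduct.rid k V).toLinearMap (TensorProduct.map LinearMap.id
      (TensorProduct.map LinearMap.id (evalLin W)) s)))
    (map_monodromy_lin (dual V) V (dual W) W _)).trans ?_
  -- Only the rightmost factor is split off; the other three have just been treated together as the
  -- conjugated monodromy.
  rw [map_mul _ _ (applySecond (applySecond comul) assoc.inv), ← act₃_tensorObj_right]
  rfl

/-- The Hopf pairing of the coend is given by `hatPairing`. -/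
theorem coadjointCoend_pairing_lin (f g : Module.Dual k A) :
    Hom.lin (coadjointCoend k A).pairing (f ⊗ₜ[k] g) =
      TensorProduct.lid k k (TensorProduct.map g f (hatPairing k A)) := by
  have h₁ : ((coadjointCoend k A).iota (regular k A) ⊗ₘ (coadjointCoend k A).iota (regular k A)) ≫
      (coadjointCoend k A).pairing = UnivCoend.pairingFamily (regular k A) (regular k A) :=
    (coadjointCoend k A).iota_desc₂ _ _ _ _
  have h₂ : Hom.lin (coadjointCoend k A).pairing (f ⊗ₜ[k] g) =
      Hom.lin (((coadjointCoend k A).iota (regular k A) ⊗ₘ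
        (coadjointCoend k A).iota (regular k A)) ≫ (coadjointCoend k A).pairing)
        ((f ⊗ₜ[k] (1 : A)) ⊗ₜ[k] (g ⊗ₜ[k] (1 : A))) :=
    -- Both arguments are written as matrix coefficients of the regular module, so that the defining
    -- property of the pairing on the double coend applies.
    congrArg₂ (fun f g : Module.Dual k A => Hom.lin (coadjointCoend k A).pairing (f ⊗ₜ[k] g))
      (matrixCoeff_regular f).symm (matrixCoeff_regular g).symm
  rw [h₂, h₁]
  refine (pairingFamily_lin _ _ _).trans ?_
  refine (evalLin_act₄ (regular k A) (regular k A) _ f (1 : A) g (1 : A)).trans ?_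
  rw [matrixCoeff_regular, matrixCoeff_regular]
  -- After regrouping, the product of the `α`s with the acting element is `W` as bracketed in
  -- `elementW`.
  simp only [← mul_assoc]
  rfl

/-- The transformation `Ω` in terms of `hatPairing`. -/
theorem coadjointCoend_Omega_lin (s : 𝟙_ (RepFin k A) ⟶ (coadjointCoend k A).obj)
    (l : Module.Dual k A) (hl : Hom.lin s (1 : k) = l) (f : Module.Dual k A) :
    Hom.lin ((coadjointCoend k A).Omega k s) f =
      f (TensorProduct.rid k A (TensorProduct.map LinearMap.id l (hatPairing k A))) := by
  -- The value is `∑ f(ω̂₁) l(ω̂₂)`, since the second argument of the pairing meets the first leg of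
  -- `ω̂`. Linearity moves the scalars inside `f`, which exhibits the form on `A*` as evaluation at
  -- one element, as the inverse of `ψ` requires.
  have key : ∀ x : A ⊗[k] A, TensorProduct.lid k k (TensorProduct.map f l x) =
      f (TensorProduct.rid k A (TensorProduct.map LinearMap.id l x)) := by
    intro x
    induction x using TensorProduct.induction_on with
    | zero => simp
    | tmul a b => simp [mul_comm]
    | add x y hx hy => simp only [map_add, hx, hy]
  rw [← key, ← coadjointCoend_pairing_lin, ← hl]
  rfl

end RepFin

/-! ### The transformations on the centre -/

section Transformations

variable {k A : Type u} [Field k] [Ring A] [Algebra k A] [Module.Finite k A]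

/-- The `S`-transformation on the centre is given by `formulaS`. -/
theorem centerS_eq_formulaS [QuasiTriangularQuasiHopfAlgebra k A]
    (Λ : 𝟙_ (RepFin k A) ⟶ (RepFin.coadjointCoend k A).obj) (z : Subalgebra.center k A) :
    (centerS Λ z : A) = formulaS (hatIntegral Λ) z := by
  -- The inverse of `ξ` takes the value at the unit of the regular module, where the inverse of `ψ`
  -- is known. The evaluation element passed to it comes from `Ω`, applied to the linear form that
  -- the remaining goal identifies.
  refine RepFin.psiInvApp_regular_one _ _ fun f => RepFin.coadjointCoend_Omega_lin _ _ ?_ f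
  -- Here `ρ` is applied to the evaluation at `α z`, the element that encodes `ψ(ξ(z))`.
  exact LinearMap.ext fun b => RepFin.coadjointCoend_rho_lin Λ _ _
    (RepFin.coadjointCoend_psi_lin z) b

/-- The `T`-transformation on the centre is multiplication by `v⁻¹`. -/
theorem centerT_eq_mul [RibbonQuasiHopfAlgebra k A] (z : Subalgebra.center k A) :
    (centerT k A z : A) = ((RepFin.ribbonUnit k A)⁻¹ : Aˣ) * z := by
  -- The final factor `1` is the unit of the regular module at which the inverse of `ξ` evaluates.
  have h : (centerT k A z : A) = (RepFin.ribbonUnit k A).inv * (z * 1) := rfl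
  rw [h, mul_one]
  rfl

end Transformations

end QuasiHopf

theorem theorem7p1 {k A : Type u} [Field k] [Ring A] [Algebra k A] [Module.Finite k A]
    [QuasiHopf.RibbonQuasiHopfAlgebra k A]
    (hA : QuasiHopf.IsFactorisable (QuasiHopf.RepFin k A))
    (Λ : 𝟙_ (QuasiHopf.RepFin k A) ⟶ (QuasiHopf.RepFin.coadjointCoend k A).obj)
    (hΛ : (QuasiHopf.RepFin.coadjointCoend k A).IsIntegral Λ)
    (hnorm : (QuasiHopf.RepFin.coadjointCoend k A).IsNormalised Λ) :
    (∀ z : Subalgebra.center k A,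
      (QuasiHopf.centerS Λ z : A) = QuasiHopf.formulaS (QuasiHopf.hatIntegral Λ) z) ∧
    (∀ z : Subalgebra.center k A,
      (QuasiHopf.centerT k A z : A) = ((QuasiHopf.RepFin.ribbonUnit k A)⁻¹ : Aˣ) * z) := by
  exact ⟨QuasiHopf.centerS_eq_formulaS Λ, QuasiHopf.centerT_eq_mul⟩
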